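/- Let $V_1,\dots,V_n$ be complete $\mathcal C^2$ vector fields on $\mathbb R^d$ with flows $\varphi^{(1)},\dots,\varphi^{(n)}$, where $\varphi^{(k)}_s(x)$ is the value at time $s\in\mathbb R$ of the solution of $\dot y=V_k(y)$, $y(0)=x$. For $t\in\mathbb R^{n}$ put $\Phi_t=\varphi^{(n)}_{t_n}\circ\cdots\circ\varphi^{(1)}_{t_1}$, and for $m\ge 0$ and $t=(t^1,\dots,t^m)\in(\mathbb R^n)^m=\mathbb R^{mn}$ put $\Phi^m(x,t)=\Phi_{t^m}\circ\cdots\circ\Phi_{t^1}(x)$. Fix $x_0\in\mathbb R^d$ and let $\mathcal X=\{\Phi^m(x_0,t): m\ge 0,\ t\in\mathbb R^{mn}\}$ be its orbit, which is an immersed submanifold of $\mathbb R^d$; let $\lambda$ be its volume measure, that is, the Riemannian volume for the metric induced by $\mathbb R^d$ (equivalently, the Hausdorff measure of dimension $\dim\mathcal X$ on $\mathcal X$). Fix $h>0$ and let $P_h$ be the transition kernel on $\mathcal X$ given by $$P_hf(x)=\int_{(0,\infty)^n} f(\Phi_{ht}(x))\,e^{-\sum_{k=1}^n t_k}\,dt$$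 for bounded measurable $f:\mathcal X\to\mathbb R$. A measure $\mu$ on $\mathcal X$ is $P_h$-invariant if $\int_{\mathcal X}P_hf\,d\mu=\int_{\mathcal X}f\,d\mu$ for all such $f$. Suppose there is a point $x_*\in\mathcal X$ such that for every $x\in\mathcal X$ there are $m\in\mathbb N$ and $t\in(0,\infty)^{mn}$ with $\Phi^m(x,t)=x_*$ and with $D_t\Phi^m(x,t):\mathbb R^{mn}\to T_{x_*}\mathcal X$ surjective. Then $P_h$ has at most one invariant probability measure on $\mathcal X$, and if such a measure exists, it is absolutely continuous with respect to $\lambda$. -/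

import Mathlib

open MeasureTheory

namespace RandomSplitting

/-- The state space `ℝ^d`, with its Euclidean norm. -/
abbrev Space (d : ℕ) : Type := EuclideanSpace ℝ (Fin d)

/-- A vector field is complete if through every point there is an integral curve that is defined
for all times. -/
def IsCompleteField {d : ℕ} (W : Space d → Space d) : Prop :=
  ∀ x : Space d, ∃ γ : ℝ → Space d, γ 0 = x ∧ IsIntegralCurve γ (fun _ => W)

open Classical in
/-- The flow `φ_s(x)` of `x' = W(x)`: the position at time `s` on the integral curve of `W` that is
at `x` at time `0`. For complete `C¹` fields this curve exists and is unique; if there is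
no such curve the value is `x`, by convention. -/
noncomputable def flow {d : ℕ} (W : Space d → Space d) (s : ℝ) (x : Space d) : Space d :=
  if H : ∃ γ : ℝ → Space d, γ 0 = x ∧ IsIntegralCurve γ (fun _ => W) then H.choose s else x

/-- One cycle of the splitting, `Φ_t = φ⁽ⁿ⁾_{t_n} ∘ ⋯ ∘ φ⁽¹⁾_{t_1}`. -/
noncomputable def cycle {d n : ℕ} (V : Fin n → Space d → Space d) (t : Fin n → ℝ)
    (x : Space d) : Space d :=
  Fin.foldl n (fun y k => flow (V k) (t k) y) x

/-- `m` cycles of the splitting, `Φ^m(x, t)`. The `m n` times are arranged as `m` blocks of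
`n` times; the block `t 0` is used first. -/
noncomputable def cycles {d n : ℕ} (V : Fin n → Space d → Space d) (m : ℕ)
    (t : Fin m → Fin n → ℝ) (x : Space d) : Space d :=
  Fin.foldl m (fun y i => cycle V (t i) y) x

/-- The orbit of `x`: all points `Φ^m(x, t)` with arbitrary real times (of either sign). -/
def orbit {d n : ℕ} (V : Fin n → Space d → Space d) (x : Space d) : Set (Space d) :=
  {y | ∃ (m : ℕ) (t : Fin m → Fin n → ℝ), cycles V m t x = y}

/-- The splitting stays in the orbit in which it starts. -/
theorem cycle_mem_orbit {d n : ℕ} (V : Fin n → Space d → Space d) (x₀ : Space d)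
    (t : Fin n → ℝ) {x : Space d} (hx : x ∈ orbit V x₀) : cycle V t x ∈ orbit V x₀ := by
  obtain ⟨m, s, rfl⟩ := hx
  refine ⟨m + 1, Fin.snoc (α := fun _ => Fin n → ℝ) s t, ?_⟩
  simp [cycles, Fin.foldl_succ_last]

/-- The tangent space at `y` of the orbit `X` of `x₀`, as a subspace of `ℝ^d`: the velocities at
`y` of the `C¹` curves in `ℝ^d` that run in `X`. Orbits are (weakly embedded) immersed
submanifolds, that is, every such curve is also `C¹` as a curve in the manifold `X`; hence this is
the usual tangent space (and the span adds nothing). -/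
def tangentSpace {d n : ℕ} (V : Fin n → Space d → Space d) (x₀ y : Space d) :
    Submodule ℝ (Space d) :=
  Submodule.span ℝ {v | ∃ γ : ℝ → Space d,
    ContDiff ℝ 1 γ ∧ (∀ s, γ s ∈ orbit V x₀) ∧ γ 0 = y ∧ deriv γ 0 = v}

/-- The dimension of the orbit of `x₀`. -/
noncomputable def orbitDim {d n : ℕ} (V : Fin n → Space d → Space d) (x₀ : Space d) : ℕ :=
  Module.finrank ℝ (tangentSpace V x₀ x₀)

/-- The volume measure `λ` on the orbit `X` of `x₀` for the Riemannian structure induced by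
`ℝ^d`: the Hausdorff measure on `X` of dimension `p = dim X`, normalized so that it is Lebesgue
measure on `ℝ^p`. -/
noncomputable def orbitVolume {d n : ℕ} (V : Fin n → Space d → Space d) (x₀ : Space d) :
    Measure (orbit V x₀) :=
  Measure.euclideanHausdorffMeasure (orbitDim V x₀)

/-- The transition operator of the random splitting on the orbit of `x₀`:
`P_h f (x) = E f(Φ_{hτ}(x)) = ∫_{(0,∞)^n} f(Φ_{ht}(x)) exp(-∑ t_k) dt`. -/
noncomputable def transition {d n : ℕ} (V : Fin n → Space d → Space d) (x₀ : Space d) (h : ℝ)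
    (f : orbit V x₀ → ℝ) (x : orbit V x₀) : ℝ :=
  ∫ t in {t : Fin n → ℝ | ∀ k, 0 < t k},
    f ⟨cycle V (fun k => h * t k) x, cycle_mem_orbit V x₀ _ x.2⟩ * Real.exp (-∑ k, t k)

/-- `μ` is a `P_h`-invariant measure on the orbit: `∫ P_h f dμ = ∫ f dμ` for all bounded
measurable `f`. -/
def IsInvariant {d n : ℕ} (V : Fin n → Space d → Space d) (x₀ : Space d) (h : ℝ)
    (μ : Measure (orbit V x₀)) : Prop :=
  ∀ f : orbit V x₀ → ℝ, Measurable f → (∃ C : ℝ, ∀ x, |f x| ≤ C) →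
    ∫ x, transition V x₀ h f x ∂μ = ∫ x, f x ∂μ

end RandomSplitting

/-!
Why the theorem holds. The flow of a complete `C¹` field is `C¹` in time and space together
(`contDiff_flow`), so the cycles are `C¹` in times and starting point, and the flows act on the
orbit by diffeomorphisms; in particular all tangent spaces of the orbit have the same dimension `p`
(`finrank_tangentSpace_eq_orbitDim`).

*A common component.* Let `T` be the tangent space at the point `x⋆` and `π` the orthogonal
projection to `T`. As `x⋆` is reached regularly from itself, say by `l` cycles with times near `u`,
the map `s ↦ Φˡ(x⋆, s)` followed by `π` is a submersion at `u`; composing `s ↦ Φˡ(x⋆, s)` with a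
local section gives `g`, a parametrization of the orbit over a neighbourhood of `π x⋆` in `T`. From
any `x`, run `m` cycles with times `r` near those that lead to `x⋆`, and then `l` cycles with times
`s` near `u`. The resulting map `H(r, s)` has rank at most `p` everywhere and `π ∘ H` is a
submersion, so by the constant rank theorem `H` factors locally as `g ∘ π ∘ H`, with the *same* `g`
for all `x`, because `H(r, ·) = Φˡ(x⋆, ·)` at the base value of `r`. Hence a set `A` that is almost
surely avoided from `x` has a preimage under `g` that is null near `π x⋆`
(`exists_parametrization`). So the manifold structure of the orbit enters only through the dimension
of its tangent spaces.

*Uniqueness.* Two distinct invariant probability measures would give two nonzero invariant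
measures that are mutually singular (`exists_mutuallySingular_invariant`), hence a set such that
both it and its complement have null preimages under `g` near `π x⋆`, which is absurd.

*Absolute continuity.* The flows preserve null sets of the volume, so the kernel preserves absolute
continuity. If an invariant measure had a singular part, that part would be invariant and live on
a null set `N` of the volume (`exists_invariant_restrict_null`). The preimage under `g` of the
complement of `N` is then null near `π x⋆`, and so is that of `N` itself, because `π` does not
increase Hausdorff measure; this is absurd again.
-/

namespace RandomSplitting

open Set Filter Topology ProbabilityTheory

/-! ### The composition operator on spaces of continuous functions -/

section Nemytskii

variable {K E F B : Type*} [TopologicalSpace K] [CompactSpace K]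
  [NormedAddCommGroup E] [NormedSpace ℝ E] [NormedAddCommGroup F] [NormedSpace ℝ F]
  [NormedAddCommGroup B] [NormedSpace ℝ B]

/-- Pointwise application `u ↦ (τ ↦ A τ (u τ))` of a continuous family of operators to
continuous functions, as an operator between spaces of continuous functions. The operators are
given by a continuous linear parametrization `ι : B → (E → F)`. -/
noncomputable def pointwiseApply (ι : B →L[ℝ] E →L[ℝ] F) (A : C(K, B)) : C(K, E) →L[ℝ] C(K, F) :=
  LinearMap.mkContinuous
    { toFun := fun u => ⟨fun τ => ι (A τ) (u τ), by fun_prop⟩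
      map_add' := fun _ _ => by ext; simp
      map_smul' := fun _ _ => by ext; simp } (‖ι‖ * ‖A‖) fun u => by
    rw [ContinuousMap.norm_le _ (by positivity)]
    intro τ
    refine (ι.le_opNorm₂ (A τ) (u τ)).trans ?_
    gcongr
    exacts [A.norm_coe_le_norm τ, u.norm_coe_le_norm τ]

@[simp]
theorem pointwiseApply_apply (ι : B →L[ℝ] E →L[ℝ] F) (A : C(K, B)) (u : C(K, E)) (τ : K) :
    pointwiseApply ι A u τ = ι (A τ) (u τ) := rfl

theorem norm_pointwiseApply_le (ι : B →L[ℝ] E →L[ℝ] F) (A : C(K, B)) :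
    ‖pointwiseApply ι A‖ ≤ ‖ι‖ * ‖A‖ :=
  LinearMap.mkContinuous_norm_le _ (by positivity) _

theorem pointwiseApply_sub (ι : B →L[ℝ] E →L[ℝ] F) (A A' : C(K, B)) :
    pointwiseApply ι (A - A') = pointwiseApply ι A - pointwiseApply ι A' := by
  ext; simp

theorem continuous_pointwiseApply (ι : B →L[ℝ] E →L[ℝ] F) :
    Continuous (pointwiseApply ι : C(K, B) → C(K, E) →L[ℝ] C(K, F)) := by
  refine continuous_iff_continuousAt.2 fun A' => tendsto_iff_norm_sub_tendsto_zero.2 ?_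
  refine squeeze_zero (fun _ => norm_nonneg _) (g := fun A : C(K, B) => ‖ι‖ * ‖A - A'‖)
    (fun A => ?_) ?_
  · rw [← pointwiseApply_sub]
    exact norm_pointwiseApply_le _ _
  · have : Continuous fun A : C(K, B) => ‖ι‖ * ‖A - A'‖ := by fun_prop
    simpa using this.tendsto A'

/-- Composition with a continuous map, on functions on a compact space. -/
abbrev nemytskii (W : C(E, F)) (u : C(K, E)) : C(K, F) := W.comp u

/-- If the increments of `W` are `W b - W a = M (a, b) (b - a)` with operators `M (a, b)` that
depend continuously on `(a, b)`, then the composition operator of `W` is `C¹` for the uniform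
norm, with pointwise application of `M (u, u)` as its derivative at `u`. -/
theorem contDiff_nemytskii_of_increment [T2Space K] {W : C(E, F)} (ι : B →L[ℝ] E →L[ℝ] F)
    (M : C(E × E, B)) (hM : ∀ a b, ι (M (a, b)) (b - a) = W b - W a) :
    ContDiff ℝ 1 (nemytskii (K := K) W) := by
  have hpair : Continuous fun p : C(K, E) × C(K, E) => M.comp (p.1.prodMk p.2) := by
    refine ContinuousMap.continuous_of_continuous_uncurry _ ?_
    change Continuous fun p : (C(K, E) × C(K, E)) × K => M (p.1.1 p.2, p.1.2 p.2)
    exact M.continuous.comp (by fun_prop)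
  rw [contDiff_one_iff_hasFDerivAt]
  refine ⟨fun u => pointwiseApply ι (M.comp (u.prodMk u)), ?_, fun u => ?_⟩
  · exact (continuous_pointwiseApply ι).comp (hpair.comp (continuous_id.prodMk continuous_id))
  have hinc : ∀ v : C(K, E), nemytskii W v - nemytskii W u -
      pointwiseApply ι (M.comp (u.prodMk u)) (v - u)
      = pointwiseApply ι (M.comp (u.prodMk v) - M.comp (u.prodMk u)) (v - u) := by
    intro v
    rw [pointwiseApply_sub, sub_apply]
    congr 1
    ext τ
    exact (hM (u τ) (v τ)).symm
  rw [hasFDerivAt_iff_isLittleO]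
  simp_rw [hinc]
  have h0 : Tendsto (fun v => ‖ι‖ * ‖M.comp (u.prodMk v) - M.comp (u.prodMk u)‖) (𝓝 u) (𝓝 0) := by
    have : Continuous fun v => ‖ι‖ * ‖M.comp (u.prodMk v) - M.comp (u.prodMk u)‖ :=
      continuous_const.mul ((hpair.comp (continuous_const.prodMk continuous_id)).sub
        continuous_const).norm
    simpa using this.tendsto u
  refine Asymptotics.isLittleO_iff.2 fun c hc => ?_
  filter_upwards [h0.eventually (gt_mem_nhds hc)] with v hv
  exact (ContinuousLinearMap.le_opNorm _ _).trans
    (mul_le_mul_of_nonneg_right ((norm_pointwiseApply_le _ _).trans hv.le) (norm_nonneg _))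

/-- The mean of the derivative of `W` over the segment from `p.1` to `p.2`. -/
noncomputable def segmentMean (W : E → F) (p : E × E) : E →L[ℝ] F :=
  ∫ σ in (0 : ℝ)..1, fderiv ℝ W (p.1 + σ • (p.2 - p.1))

theorem continuous_segmentMean {W : E → F} (hW : ContDiff ℝ 1 W) :
    Continuous (segmentMean W) := by
  unfold segmentMean
  have h := hW.continuous_fderiv one_ne_zero
  exact intervalIntegral.continuous_parametric_intervalIntegral_of_continuous' (by
    unfold Function.uncurry; fun_prop) 0 1

/-- The fundamental theorem of calculus along a segment. -/
theorem segmentMean_apply_sub [CompleteSpace F] {W : E → F} (hW : ContDiff ℝ 1 W) (a b : E) :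
    segmentMean W (a, b) (b - a) = W b - W a := by
  have h := hW.continuous_fderiv one_ne_zero
  unfold segmentMean
  rw [ContinuousLinearMap.intervalIntegral_apply
    (Continuous.intervalIntegrable (by fun_prop) _ _)]
  have hd : ∀ σ ∈ uIcc (0 : ℝ) 1, HasDerivAt (fun σ : ℝ => W (a + σ • (b - a)))
      (fderiv ℝ W (a + σ • (b - a)) (b - a)) σ := by
    intro σ _
    have h1 : HasDerivAt (fun σ : ℝ => a + σ • (b - a)) (b - a) σ := by
      simpa using ((hasDerivAt_id σ).smul_const (b - a)).const_add a
    exact ((hW.differentiable one_ne_zero _).hasFDerivAt).comp_hasDerivAt σ h1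
  rw [intervalIntegral.integral_eq_sub_of_hasDerivAt hd
    (Continuous.intervalIntegrable (by fun_prop) _ _)]
  simp

/-- The composition operator of a `C¹` map is `C¹` for the uniform norm. -/
theorem contDiff_nemytskii [T2Space K] [CompleteSpace F] {W : C(E, F)} (hW : ContDiff ℝ 1 W) :
    ContDiff ℝ 1 (nemytskii (K := K) W) :=
  contDiff_nemytskii_of_increment (B := E →L[ℝ] F) (.id ℝ _)
    ⟨segmentMean W, continuous_segmentMean hW⟩ fun a b => segmentMean_apply_sub hW a b

end Nemytskii

/-! ### Local dependence of solutions on time and initial value -/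

section LocalFlow

variable {E : Type*} [NormedAddCommGroup E] [NormedSpace ℝ E]

/-- Two solutions of `f' = a W(f)` on `[0, 1]` with the same initial value have the same value at
time `1`. -/
theorem eq_at_one_of_hasDerivAt [FiniteDimensional ℝ E] {W : E → E} (hW : ContDiff ℝ 1 W) (a : ℝ)
    {f g : ℝ → E}
    (hf : ∀ τ ∈ Icc (0 : ℝ) 1, HasDerivAt f (a • W (f τ)) τ)
    (hg : ∀ τ ∈ Icc (0 : ℝ) 1, HasDerivAt g (a • W (g τ)) τ) (h0 : f 0 = g 0) : f 1 = g 1 := by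
  have : ProperSpace E := FiniteDimensional.proper ℝ E
  have hfc : ContinuousOn f (Icc 0 1) := fun τ hτ => (hf τ hτ).continuousAt.continuousWithinAt
  have hgc : ContinuousOn g (Icc 0 1) := fun τ hτ => (hg τ hτ).continuousAt.continuousWithinAt
  obtain ⟨R, hR⟩ := ((isCompact_Icc.image_of_continuousOn hfc).union
    (isCompact_Icc.image_of_continuousOn hgc)).isBounded.subset_closedBall 0
  obtain ⟨C, hC⟩ := (((hW.const_smul a).contDiffOn (s := Metric.closedBall (0 : E) R))
    ).exists_lipschitzOnWith one_ne_zero (convex_closedBall _ _) (isCompact_closedBall _ _)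
  refine ODE_solution_unique_of_mem_Icc_right (v := fun _ x => a • W x)
    (s := fun _ => Metric.closedBall (0 : E) R) (a := 0) (b := 1) (K := C)
    (fun _ _ => hC) hfc (fun τ hτ => ?_) (fun τ hτ => ?_) hgc (fun τ hτ => ?_) (fun τ hτ => ?_) h0
    (right_mem_Icc.2 zero_le_one)
  · exact (hf τ (Ico_subset_Icc_self hτ)).hasDerivWithinAt
  · exact hR (Or.inl (mem_image_of_mem f (Ico_subset_Icc_self hτ)))
  · exact (hg τ (Ico_subset_Icc_self hτ)).hasDerivWithinAt
  · exact hR (Or.inr (mem_image_of_mem g (Ico_subset_Icc_self hτ)))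

/-- The constant functions on the unit interval, as a continuous linear map. -/
noncomputable def constPath : E →L[ℝ] C(unitInterval, E) :=
  LinearMap.mkContinuous
    { toFun := fun x => ContinuousMap.const _ x
      map_add' := fun _ _ => by ext; simp
      map_smul' := fun _ _ => by ext; simp } 1 fun x => by
    rw [ContinuousMap.norm_le _ (by positivity)]
    simp

@[simp]
theorem constPath_apply (x : E) (τ : unitInterval) : constPath x τ = x := rfl

/-- The primitive `τ ↦ ∫₀^τ u` of a continuous function on the unit interval. -/
noncomputable def primitivePath : C(unitInterval, E) →L[ℝ] C(unitInterval, E) :=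
  LinearMap.mkContinuous
    { toFun := fun u => ⟨fun τ => ∫ σ in (0 : ℝ)..τ, u (projIcc 0 1 zero_le_one σ), by
        refine (intervalIntegral.continuous_primitive (fun _ _ => ?_) 0).comp continuous_subtype_val
        exact Continuous.intervalIntegrable (by fun_prop) _ _⟩
      map_add' := fun u v => by
        ext τ
        exact intervalIntegral.integral_add (Continuous.intervalIntegrable (by fun_prop) _ _)
          (Continuous.intervalIntegrable (by fun_prop) _ _)
      map_smul' := fun c u => by
        ext τ
        exact intervalIntegral.integral_smul c _ } 1 fun u => by
    rw [ContinuousMap.norm_le _ (by positivity)]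
    intro τ
    refine (intervalIntegral.norm_integral_le_of_norm_le_const
      (C := ‖u‖) fun σ _ => u.norm_coe_le_norm _).trans ?_
    rw [sub_zero, abs_of_nonneg τ.2.1, mul_comm]
    exact mul_le_mul_of_nonneg_right τ.2.2 (norm_nonneg _)

@[simp]
theorem primitivePath_apply (u : C(unitInterval, E)) (τ : unitInterval) :
    primitivePath u τ = ∫ σ in (0 : ℝ)..τ, u (projIcc 0 1 zero_le_one σ) := rfl

/-- The defect of a curve `y` as a solution of `y' = a W(y)`, `y(0) = x` on the unit interval,
in integrated form. -/
noncomputable def flowDefect (W : C(E, E)) (p : (ℝ × E) × C(unitInterval, E)) :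
    C(unitInterval, E) :=
  p.2 - constPath p.1.2 - p.1.1 • primitivePath (nemytskii W p.2)

theorem contDiff_flowDefect [CompleteSpace E] {W : C(E, E)} (hW : ContDiff ℝ 1 W) :
    ContDiff ℝ 1 (flowDefect W) := by
  have h := (contDiff_nemytskii (K := unitInterval) hW).comp
    (contDiff_snd : ContDiff ℝ 1 (Prod.snd : (ℝ × E) × C(unitInterval, E) → _))
  have h1 := primitivePath.contDiff.comp h
  have h2 : ContDiff ℝ 1 fun p : (ℝ × E) × C(unitInterval, E) => constPath p.1.2 :=
    (constPath : E →L[ℝ] C(unitInterval, E)).contDiff.comp contDiff_fst.snd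
  exact (contDiff_snd.sub h2).sub (contDiff_fst.fst.smul h1)

/-- A zero of the defect is a solution, hence its end point is that of any other solution. -/
theorem eval_one_of_flowDefect_eq_zero [FiniteDimensional ℝ E] {W : C(E, E)} (hW : ContDiff ℝ 1 W)
    {a : ℝ} {x : E} {y : C(unitInterval, E)} (hy : flowDefect W ((a, x), y) = 0) {g : ℝ → E}
    (hg : ∀ τ ∈ Icc (0 : ℝ) 1, HasDerivAt g (a • W (g τ)) τ) (h0 : g 0 = x) : y 1 = g 1 := by
  have : CompleteSpace E := FiniteDimensional.complete ℝ E
  set f : ℝ → E := fun τ => x + a • ∫ σ in (0 : ℝ)..τ, W (y (projIcc 0 1 zero_le_one σ)) with hf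
  have hfy : ∀ τ : unitInterval, f τ = y τ := by
    intro τ
    have := DFunLike.congr_fun hy τ
    simp only [flowDefect, ContinuousMap.sub_apply, ContinuousMap.smul_apply, constPath_apply,
      primitivePath_apply, ContinuousMap.comp_apply, ContinuousMap.zero_apply] at this
    rw [sub_sub, sub_eq_zero] at this
    exact this.symm
  have hd : ∀ τ ∈ Icc (0 : ℝ) 1, HasDerivAt f (a • W (f τ)) τ := by
    intro τ hτ
    have h1 : HasDerivAt (fun τ => ∫ σ in (0 : ℝ)..τ, W (y (projIcc 0 1 zero_le_one σ)))
        (W (y (projIcc 0 1 zero_le_one τ))) τ :=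
      have hcont : Continuous fun σ => W (y (projIcc 0 1 zero_le_one σ)) := by fun_prop
      intervalIntegral.integral_hasDerivAt_right (hcont.intervalIntegrable _ _)
        hcont.aestronglyMeasurable.stronglyMeasurableAtFilter hcont.continuousAt
    have h2 := (h1.const_smul a).const_add x
    rwa [projIcc_of_mem _ hτ, ← hfy ⟨τ, hτ⟩] at h2
  rw [← eq_at_one_of_hasDerivAt hW a hd hg (by simp [hf, h0])]
  exact (hfy 1).symm

/-- The solution map of a `C¹` field is `C¹` near time `0`: rescaled to the unit interval, the curves
are zeros of `flowDefect`, whose derivative in the curve is the identity for `a = 0`, so the implicit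
function theorem applies. -/
theorem contDiffAt_zero_of_solution [FiniteDimensional ℝ E] {W : E → E} (hW : ContDiff ℝ 1 W)
    {φ : ℝ → E → E} (h0 : ∀ x, φ 0 x = x)
    (hφ : ∀ x s, HasDerivAt (fun s => φ s x) (W (φ s x)) s) (x : E) :
    ContDiffAt ℝ 1 (fun p : ℝ × E => φ p.1 p.2) (0, x) := by
  have : CompleteSpace E := FiniteDimensional.complete ℝ E
  let Wc : C(E, E) := ⟨W, hW.continuous⟩
  have hΨ : ContDiff ℝ 1 (flowDefect Wc) := contDiff_flowDefect (W := Wc) hW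
  set u : (ℝ × E) × C(unitInterval, E) := ((0, x), constPath x) with hu
  have hΨu : ContDiffAt ℝ 1 (flowDefect Wc) u := hΨ.contDiffAt
  have hinv : (fderiv ℝ (flowDefect Wc) u ∘L .inr ℝ (ℝ × E) C(unitInterval, E)).IsInvertible := by
    have h1 : HasFDerivAt (fun y => flowDefect Wc ((0, x), y))
        (fderiv ℝ (flowDefect Wc) u ∘L .inr ℝ (ℝ × E) C(unitInterval, E)) (constPath x) :=
      (hΨ.differentiable one_ne_zero u).hasFDerivAt.comp (constPath x)
        (hasFDerivAt_prodMk_right (0, x) (constPath x))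
    have h2 : HasFDerivAt (fun y => flowDefect Wc ((0, x), y)) (.id ℝ C(unitInterval, E))
        (constPath x) := by
      have : (fun y => flowDefect Wc ((0, x), y)) = fun y => y - constPath x := by
        funext y; simp [flowDefect]
      rw [this]
      exact (hasFDerivAt_id _).sub_const _
    rw [h1.unique h2]
    exact ⟨.refl ℝ _, rfl⟩
  have hz : flowDefect Wc u = 0 := by simp [flowDefect, hu]
  have hY := hΨu.contDiffAt_implicitFunction one_ne_zero hinv
  have hYz := hΨu.eventually_apply_implicitFunction one_ne_zero hinv
  set Y := hΨu.implicitFunction one_ne_zero hinv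
  have hev : ContDiffAt ℝ 1 (fun p => Y p 1) (0, x) :=
    ContDiffAt.comp (0, x)
      (ContinuousMap.evalCLM ℝ (1 : unitInterval) : C(unitInterval, E) →L[ℝ] E).contDiff.contDiffAt
      hY
  refine hev.congr_of_eventuallyEq ?_
  filter_upwards [hYz] with p hp
  rw [hz] at hp
  have := eval_one_of_flowDefect_eq_zero (W := Wc) hW hp (g := fun τ => φ (p.1 * τ) p.2)
    (fun τ _ => ?_) (by simp [h0])
  · simpa using this.symm
  · have := (hφ p.2 (p.1 * τ)).scomp τ ((hasDerivAt_id τ).const_mul p.1)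
    simpa [Function.comp_def, Wc] using this

end LocalFlow

/-! ### Flows of complete fields -/

section Flow

variable {d : ℕ} {W : Space d → Space d}

theorem flow_spec (hc : IsCompleteField W) (x : Space d) :
    flow W 0 x = x ∧ ∀ s, HasDerivAt (fun s => flow W s x) (W (flow W s x)) s := by
  have h : ∀ s, flow W s x = (hc x).choose s := fun s => by
    unfold flow
    rw [dif_pos (hc x)]
  simp_rw [h]
  exact (hc x).choose_spec

theorem flow_zero (hc : IsCompleteField W) (x : Space d) : flow W 0 x = x := (flow_spec hc x).1

theorem hasDerivAt_flow (hc : IsCompleteField W) (x : Space d) (s : ℝ) :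
    HasDerivAt (fun s => flow W s x) (W (flow W s x)) s := (flow_spec hc x).2 s

theorem flow_add (hW : ContDiff ℝ 1 W) (hc : IsCompleteField W) (s u : ℝ) (x : Space d) :
    flow W (s + u) x = flow W u (flow W s x) := by
  have := eq_at_one_of_hasDerivAt hW u (f := fun τ => flow W (s + u * τ) x)
    (g := fun τ => flow W (u * τ) (flow W s x)) (fun τ _ => ?_) (fun τ _ => ?_)
    (by simp [flow_zero hc])
  · simpa using this
  · simpa [Function.comp_def] using (hasDerivAt_flow hc x (s + u * τ)).scomp τ
      (((hasDerivAt_id τ).const_mul u).const_add s)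
  · simpa [Function.comp_def] using (hasDerivAt_flow hc (flow W s x) (u * τ)).scomp τ
      ((hasDerivAt_id τ).const_mul u)

theorem flow_neg_flow (hW : ContDiff ℝ 1 W) (hc : IsCompleteField W) (s : ℝ) (x : Space d) :
    flow W (-s) (flow W s x) = x := by
  rw [← flow_add hW hc, add_neg_cancel, flow_zero hc]

theorem flow_flow_neg (hW : ContDiff ℝ 1 W) (hc : IsCompleteField W) (s : ℝ) (x : Space d) :
    flow W s (flow W (-s) x) = x := by
  rw [← flow_add hW hc, neg_add_cancel, flow_zero hc]

/-- The flow of a complete `C¹` field is `C¹` in time and initial point together. Near time `0`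
this is the implicit function theorem; the set of times at which it holds is open and, by
the group property, closed. -/
theorem contDiff_flow (hW : ContDiff ℝ 1 W) (hc : IsCompleteField W) :
    ContDiff ℝ 1 fun p : ℝ × Space d => flow W p.1 p.2 := by
  rw [contDiff_iff_contDiffAt]
  rintro ⟨s, x⟩
  have hloc := contDiffAt_zero_of_solution hW (flow_zero hc) (hasDerivAt_flow hc)
  set J : Set ℝ := {s | ContDiffAt ℝ 1 (fun p : ℝ × Space d => flow W p.1 p.2) (s, x)} with hJ
  have hopen : IsOpen J := by
    rw [isOpen_iff_mem_nhds]
    intro s hs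
    have := (show ContDiffAt ℝ 1 (fun p : ℝ × Space d => flow W p.1 p.2) (s, x) from hs).eventually
      (by simp)
    exact (Continuous.prodMk_left x).continuousAt.eventually this
  have hclosed : IsClosed J := by
    refine isClosed_of_closure_subset fun s hs => ?_
    have h1 : ∀ᶠ q : ℝ in 𝓝 s, ContDiffAt ℝ 1 (fun p : ℝ × Space d => flow W p.1 p.2)
        (s - q, flow W q x) := by
      have hcont : ContinuousAt (fun q : ℝ => (s - q, flow W q x)) s :=
        (continuousAt_const.sub continuousAt_id).prodMk (hasDerivAt_flow hc x s).continuousAt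
      refine hcont.eventually ?_
      simp only [sub_self]
      exact (hloc (flow W s x)).eventually (by simp)
    -- `φ_s = φ_{s-q} ∘ φ_q` for a time `q ∈ J` so close to `s` that `φ_{s-q}` is covered by the
    -- case of small times.
    obtain ⟨q, hqJ, hq⟩ := (mem_closure_iff_frequently.1 hs).and_eventually h1 |>.exists
    have hin : ContDiffAt ℝ 1 (fun p : ℝ × Space d => (p.1 - q, flow W q p.2)) (s, x) := by
      refine (contDiffAt_fst.sub contDiffAt_const).prodMk ?_
      exact ContDiffAt.comp (g := fun p : ℝ × Space d => flow W p.1 p.2) (s, x)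
        (show ContDiffAt ℝ 1 (fun p : ℝ × Space d => flow W p.1 p.2) (q, x) from hqJ)
        (contDiffAt_const.prodMk contDiffAt_snd)
    have := ContDiffAt.comp (g := fun p : ℝ × Space d => flow W p.1 p.2) (s, x) hq hin
    refine this.congr_of_eventuallyEq (Eventually.of_forall fun p => ?_)
    simp [← flow_add hW hc]
  have : J = univ := IsClopen.eq_univ ⟨hclosed, hopen⟩ ⟨0, hloc x⟩
  exact eq_univ_iff_forall.1 this s

end Flow

/-! ### Iterated compositions -/

section Fold

variable {P E : Type*}

theorem foldl_induction {m : ℕ} {f : E → Fin m → E} {p : E → Prop} (hf : ∀ y i, p y → p (f y i))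
    {x : E} (hx : p x) : p (Fin.foldl m f x) := by
  induction m with
  | zero => simpa using hx
  | succ m ih =>
    rw [Fin.foldl_succ_last]
    exact hf _ _ (ih fun y i => hf y i.castSucc)

/-- A fold in which all steps but the `k`-th do nothing. -/
theorem foldl_eq_of_unique_step {m : ℕ} {f : E → Fin m → E} (k : Fin m)
    (hf : ∀ i, i ≠ k → ∀ y, f y i = y) (x : E) : Fin.foldl m f x = f x k := by
  induction m with
  | zero => exact k.elim0
  | succ m ih =>
    rw [Fin.foldl_succ_last]
    induction k using Fin.lastCases with
    | last =>
      congr 1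
      exact foldl_induction (p := fun y => y = x)
        (fun y i hy => (hf _ (Fin.castSucc_lt_last i).ne y).trans hy) rfl
    | cast k =>
      rw [hf _ (Fin.castSucc_lt_last k).ne', ih k]
      exact fun i hi => hf _ fun h => hi (Fin.castSucc_injective m h)

variable [NormedAddCommGroup P] [NormedSpace ℝ P] [NormedAddCommGroup E] [NormedSpace ℝ E]

theorem contDiff_foldl {m : ℕ} {f : P → E → Fin m → E}
    (hf : ∀ i, ContDiff ℝ 1 fun q : P × E => f q.1 q.2 i) :
    ContDiff ℝ 1 fun q : P × E => Fin.foldl m (f q.1) q.2 := by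
  induction m with
  | zero => simpa using contDiff_snd
  | succ m ih =>
    simp_rw [Fin.foldl_succ_last]
    exact (hf (Fin.last m)).comp
      (contDiff_fst.prodMk (ih (f := fun p y i => f p y i.castSucc) fun i => hf i.castSucc))

end Fold

/-! ### Orbits, their tangent spaces and their volume -/

section Orbit

variable {d n : ℕ} {V : Fin n → Space d → Space d}

theorem contDiff_cycle (hV : ∀ k, ContDiff ℝ 1 (V k)) (hc : ∀ k, IsCompleteField (V k)) :
    ContDiff ℝ 1 fun p : (Fin n → ℝ) × Space d => cycle V p.1 p.2 := by
  refine contDiff_foldl (f := fun (t : Fin n → ℝ) y k => flow (V k) (t k) y) fun k => ?_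
  exact (contDiff_flow (hV k) (hc k)).comp
    (g := fun p : ℝ × Space d => flow (V k) p.1 p.2)
    (f := fun q : (Fin n → ℝ) × Space d => (q.1 k, q.2)) (by fun_prop)

theorem contDiff_cycles (hV : ∀ k, ContDiff ℝ 1 (V k)) (hc : ∀ k, IsCompleteField (V k)) (m : ℕ) :
    ContDiff ℝ 1 fun p : (Fin m → Fin n → ℝ) × Space d => cycles V m p.1 p.2 := by
  refine contDiff_foldl (f := fun (t : Fin m → Fin n → ℝ) y i => cycle V (t i) y) fun i => ?_
  exact (contDiff_cycle hV hc).comp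
    (g := fun p : (Fin n → ℝ) × Space d => cycle V p.1 p.2)
    (f := fun q : (Fin m → Fin n → ℝ) × Space d => (q.1 i, q.2)) (by fun_prop)

theorem cycles_mem_orbit (x₀ : Space d) {m : ℕ} (t : Fin m → Fin n → ℝ) {x : Space d}
    (hx : x ∈ orbit V x₀) : cycles V m t x ∈ orbit V x₀ :=
  foldl_induction (p := fun y => y ∈ orbit V x₀) (fun _ _ hy => cycle_mem_orbit V x₀ _ hy) hx

theorem cycle_single (hc : ∀ k, IsCompleteField (V k)) (k : Fin n) (s : ℝ) (x : Space d) :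
    cycle V (Pi.single k s) x = flow (V k) s x := by
  unfold cycle
  rw [foldl_eq_of_unique_step k fun i hi y => by rw [Pi.single_eq_of_ne hi, flow_zero (hc i)]]
  simp

/-- A single flow is a cycle in which all other times are `0`. -/
theorem flow_mem_orbit (hc : ∀ k, IsCompleteField (V k)) (k : Fin n) (s : ℝ) {x₀ x : Space d}
    (hx : x ∈ orbit V x₀) : flow (V k) s x ∈ orbit V x₀ :=
  cycle_single hc k s x ▸ cycle_mem_orbit V x₀ _ hx

/-- A `C¹` map into an orbit has its derivatives in the tangent spaces of the orbit. -/
theorem range_fderiv_le_tangentSpace {P : Type*} [NormedAddCommGroup P] [NormedSpace ℝ P]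
    {x₀ : Space d} {F : P → Space d} (hF : ContDiff ℝ 1 F) (hmem : ∀ p, F p ∈ orbit V x₀) (p : P) :
    (fderiv ℝ F p).range ≤ tangentSpace V x₀ (F p) := by
  rintro _ ⟨v, rfl⟩
  refine Submodule.subset_span ⟨fun s => F (p + s • v), hF.comp (by fun_prop), fun s => hmem _,
    by simp, ?_⟩
  have h1 : HasDerivAt (fun s : ℝ => p + s • v) v 0 := by
    simpa using ((hasDerivAt_id (0 : ℝ)).smul_const v).const_add p
  have h2 : HasFDerivAt F (fderiv ℝ F p) (p + (0 : ℝ) • v) := by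
    rw [zero_smul, add_zero]
    exact (hF.differentiable one_ne_zero p).hasFDerivAt
  exact (h2.comp_hasDerivAt 0 h1).deriv

/-- A `C¹` map that preserves the orbit maps tangent spaces to tangent spaces. If it has a
differentiable left inverse, its derivative is injective. -/
theorem finrank_tangentSpace_le {x₀ : Space d} {φ ψ : Space d → Space d} (hφ : ContDiff ℝ 1 φ)
    (hψ : Differentiable ℝ ψ) (hinv : ∀ y, ψ (φ y) = y)
    (hmem : ∀ y ∈ orbit V x₀, φ y ∈ orbit V x₀) (y : Space d) :
    Module.finrank ℝ (tangentSpace V x₀ y) ≤ Module.finrank ℝ (tangentSpace V x₀ (φ y)) := by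
  have hd := (hφ.differentiable one_ne_zero y).hasFDerivAt
  have hcomp : (fderiv ℝ ψ (φ y)).comp (fderiv ℝ φ y) = .id ℝ (Space d) := by
    have h1 := (hψ (φ y)).hasFDerivAt.comp y hd
    have h2 : ψ ∘ φ = id := funext hinv
    rw [h2] at h1
    exact h1.unique (hasFDerivAt_id y)
  have hinj : Function.Injective (fderiv ℝ φ y : Space d →ₗ[ℝ] Space d) := by
    intro a b hab
    have := congrArg (fderiv ℝ ψ (φ y)) hab
    simpa [← ContinuousLinearMap.comp_apply, hcomp] using this
  have hle : (tangentSpace V x₀ y).map (fderiv ℝ φ y : Space d →ₗ[ℝ] Space d) ≤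
      tangentSpace V x₀ (φ y) := by
    unfold tangentSpace
    rw [Submodule.map_span_le]
    rintro _ ⟨γ, hγ, hγm, rfl, rfl⟩
    refine Submodule.subset_span ⟨φ ∘ γ, hφ.comp hγ, fun s => hmem _ (hγm s), rfl, ?_⟩
    exact (hd.comp_hasDerivAt 0 (hγ.differentiable one_ne_zero 0).hasDerivAt).deriv
  exact (LinearEquiv.finrank_eq
    (Submodule.equivMapOfInjective _ hinj (tangentSpace V x₀ y))).trans_le
    (Submodule.finrank_mono hle)

theorem contDiff_flow_apply {W : Space d → Space d} (hW : ContDiff ℝ 1 W)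
    (hc : IsCompleteField W) (s : ℝ) : ContDiff ℝ 1 (flow W s) :=
  (contDiff_flow hW hc).comp (contDiff_const.prodMk contDiff_id)

/-- All tangent spaces of an orbit have the same dimension, as the flows act on the orbit by
diffeomorphisms and transitively. -/
theorem finrank_tangentSpace_eq_orbitDim (hV : ∀ k, ContDiff ℝ 1 (V k))
    (hc : ∀ k, IsCompleteField (V k)) {x₀ y : Space d} (hy : y ∈ orbit V x₀) :
    Module.finrank ℝ (tangentSpace V x₀ y) = orbitDim V x₀ := by
  obtain ⟨m, t, rfl⟩ := hy
  refine foldl_induction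
    (p := fun y => Module.finrank ℝ (tangentSpace V x₀ y) = orbitDim V x₀) (fun y i hy => ?_) rfl
  refine foldl_induction
    (p := fun y => Module.finrank ℝ (tangentSpace V x₀ y) = orbitDim V x₀) (fun y k hy => ?_) hy
  rw [← hy]
  refine le_antisymm ?_ ?_
  · have := finrank_tangentSpace_le (V := V) (x₀ := x₀)
      (contDiff_flow_apply (hV k) (hc k) (-t i k))
      ((contDiff_flow_apply (hV k) (hc k) (t i k)).differentiable one_ne_zero)
      (flow_flow_neg (hV k) (hc k) _) (fun z hz => flow_mem_orbit hc k _ hz)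
      (flow (V k) (t i k) y)
    rwa [flow_neg_flow (hV k) (hc k)] at this
  · exact finrank_tangentSpace_le (contDiff_flow_apply (hV k) (hc k) _)
      ((contDiff_flow_apply (hV k) (hc k) (-t i k)).differentiable one_ne_zero)
      (flow_neg_flow (hV k) (hc k) _) (fun z hz => flow_mem_orbit hc k _ hz) y

/-- `C¹` maps of a finite-dimensional space are Lipschitz on balls, so they preserve Hausdorff null
sets of every dimension. -/
theorem hausdorffMeasure_image_eq_zero {E : Type*} [NormedAddCommGroup E] [NormedSpace ℝ E]
    [FiniteDimensional ℝ E] [MeasurableSpace E] [BorelSpace E] {φ : E → E} (hφ : ContDiff ℝ 1 φ)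
    {p : ℝ} (hp : 0 ≤ p) {S : Set E} (hS : μH[p] S = 0) : μH[p] (φ '' S) = 0 := by
  have : ProperSpace E := FiniteDimensional.proper ℝ E
  have hcover : φ '' S = ⋃ R : ℕ, φ '' (S ∩ Metric.closedBall 0 R) := by
    rw [← image_iUnion, ← inter_iUnion, Metric.iUnion_closedBall_nat, inter_univ]
  rw [hcover, measure_iUnion_null_iff]
  intro R
  obtain ⟨C, hC⟩ := (hφ.contDiffOn (s := Metric.closedBall (0 : E) R)).exists_lipschitzOnWith
    one_ne_zero (convex_closedBall _ _) (isCompact_closedBall _ _)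
  refine le_antisymm ?_ zero_le
  refine ((hC.mono inter_subset_right).hausdorffMeasure_image_le hp).trans ?_
  rw [measure_mono_null inter_subset_left hS, mul_zero]

theorem hausdorffMeasure_preimage_cycle_eq_zero (hV : ∀ k, ContDiff ℝ 1 (V k))
    (hc : ∀ k, IsCompleteField (V k)) (t : Fin n → ℝ) {p : ℝ} (hp : 0 ≤ p) {S : Set (Space d)}
    (hS : μH[p] S = 0) : μH[p] (cycle V t ⁻¹' S) = 0 := by
  have key : ∀ (m : ℕ) (f : Space d → Fin m → Space d)
      (_ : ∀ (i : Fin m) (S : Set (Space d)), μH[p] S = 0 → μH[p] ((f · i) ⁻¹' S) = 0)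
      (S : Set (Space d)), μH[p] S = 0 → μH[p] (Fin.foldl m f ⁻¹' S) = 0 := by
    intro m
    induction m with
    | zero => intro f _ S hS; simpa [Set.preimage] using hS
    | succ m ih =>
      intro f hf S hS
      have := ih (fun y i => f y i.castSucc) (fun i => hf i.castSucc) _ (hf (Fin.last m) S hS)
      have h : Fin.foldl (m + 1) f =
          fun x => f (Fin.foldl m (fun y i => f y i.castSucc) x) (Fin.last m) :=
        funext fun x => Fin.foldl_succ_last f x
      rw [h]
      exact this
  refine key n (fun y k => flow (V k) (t k) y) (fun k S hS => ?_) S hS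
  refine measure_mono_null ?_ (hausdorffMeasure_image_eq_zero
    (contDiff_flow_apply (hV k) (hc k) (-t k)) hp hS)
  exact fun x hx => ⟨_, hx, flow_neg_flow (hV k) (hc k) _ _⟩

/-- The Riemannian volume of an orbit and the Hausdorff measure of the ambient space have the same
null sets in the orbit. -/
theorem orbitVolume_eq_zero_iff {x₀ : Space d} {S : Set (orbit V x₀)} :
    orbitVolume V x₀ S = 0 ↔ μH[(orbitDim V x₀ : ℝ)] (Subtype.val '' S) = 0 := by
  rw [orbitVolume, Measure.euclideanHausdorffMeasure_def, Measure.smul_apply,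
    isometry_subtype_coe.hausdorffMeasure_image (Or.inl (Nat.cast_nonneg _)),
    smul_eq_zero_iff_right (Measure.addHaarScalarFactor_volume_hausdorffMeasure_ne_zero _)]

/-- One cycle of the splitting, as a map of the orbit to itself. -/
noncomputable def orbitCycle (V : Fin n → Space d → Space d) (x₀ : Space d) (t : Fin n → ℝ)
    (x : orbit V x₀) : orbit V x₀ := ⟨cycle V t x, cycle_mem_orbit V x₀ t x.2⟩

/-- `m` cycles of the splitting, as a map of the orbit to itself. -/
noncomputable def orbitCycles (V : Fin n → Space d → Space d) (x₀ : Space d) (m : ℕ)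
    (t : Fin m → Fin n → ℝ) (x : orbit V x₀) : orbit V x₀ :=
  ⟨cycles V m t x, cycles_mem_orbit x₀ t x.2⟩

theorem continuous_orbitCycle (hV : ∀ k, ContDiff ℝ 1 (V k)) (hc : ∀ k, IsCompleteField (V k))
    (x₀ : Space d) : Continuous fun p : (Fin n → ℝ) × orbit V x₀ => orbitCycle V x₀ p.1 p.2 :=
  Continuous.subtype_mk ((contDiff_cycle hV hc).continuous.comp
    (continuous_fst.prodMk (continuous_subtype_val.comp continuous_snd))) _

theorem continuous_orbitCycles (hV : ∀ k, ContDiff ℝ 1 (V k)) (hc : ∀ k, IsCompleteField (V k))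
    (x₀ : Space d) (m : ℕ) :
    Continuous fun p : (Fin m → Fin n → ℝ) × orbit V x₀ => orbitCycles V x₀ m p.1 p.2 :=
  Continuous.subtype_mk ((contDiff_cycles hV hc m).continuous.comp
    (continuous_fst.prodMk (continuous_subtype_val.comp continuous_snd))) _

theorem orbitVolume_preimage_orbitCycle_eq_zero (hV : ∀ k, ContDiff ℝ 1 (V k))
    (hc : ∀ k, IsCompleteField (V k)) {x₀ : Space d} (t : Fin n → ℝ) {S : Set (orbit V x₀)}
    (hS : orbitVolume V x₀ S = 0) : orbitVolume V x₀ (orbitCycle V x₀ t ⁻¹' S) = 0 := by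
  rw [orbitVolume_eq_zero_iff] at hS ⊢
  refine measure_mono_null ?_
    (hausdorffMeasure_preimage_cycle_eq_zero hV hc t (Nat.cast_nonneg _) hS)
  rintro _ ⟨x, hx, rfl⟩
  exact ⟨_, hx, rfl⟩

end Orbit

/-! ### The constant rank theorem -/

section ConstantRank

variable {E F T : Type*} [NormedAddCommGroup E] [NormedSpace ℝ E] [FiniteDimensional ℝ E]
  [NormedAddCommGroup F] [NormedSpace ℝ F]
  [NormedAddCommGroup T] [NormedSpace ℝ T] [FiniteDimensional ℝ T]

/-- If `π ∘ A` is the first projection and the rank of `A` is not larger than that of `π ∘ A`, then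
`A` has the same kernel as the first projection. -/
theorem apply_zero_prod_eq_zero {K : Type*} [AddCommGroup K] [Module ℝ K] [FiniteDimensional ℝ K]
    (A : T × K →ₗ[ℝ] F) (π : F →ₗ[ℝ] T) (hA : π ∘ₗ A = LinearMap.fst ℝ T K)
    (hr : Module.finrank ℝ A.range ≤ Module.finrank ℝ T) (w : K) : A (0, w) = 0 := by
  have hle : A.ker ≤ (LinearMap.fst ℝ T K).ker := by
    intro z hz
    rw [← hA, LinearMap.mem_ker, LinearMap.comp_apply, LinearMap.mem_ker.1 hz, map_zero]
  have h1 := A.finrank_range_add_finrank_ker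
  have h2 := (LinearMap.fst ℝ T K).finrank_range_add_finrank_ker
  rw [LinearMap.range_eq_top.2 LinearMap.fst_surjective, finrank_top] at h2
  have heq := Submodule.eq_of_le_of_finrank_le hle (by omega)
  have : ((0, w) : T × K) ∈ A.ker := heq ▸ (by simp)
  exact this

/-- Straightening of a submersion: a chart whose first coordinate is the submersion. -/
theorem exists_chart_of_submersion {f : E → T} (hf : ContDiff ℝ 1 f) {e₀ : E}
    (hs : (fderiv ℝ f e₀).range = ⊤) :
    ∃ (κ : E →L[ℝ] (fderiv ℝ f e₀).ker)
      (Φ : OpenPartialHomeomorph E (T × (fderiv ℝ f e₀).ker)),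
      e₀ ∈ Φ.source ∧ (∀ e, Φ e = (f e, κ e)) ∧ ContDiffAt ℝ 1 Φ.symm (Φ e₀) := by
  obtain ⟨L, hL⟩ := (fderiv ℝ f e₀).exists_rightInverse_of_surjective hs
  have hL' : ∀ y, fderiv ℝ f e₀ (L y) = y := fun y => congr($hL y)
  let κ : E →L[ℝ] (fderiv ℝ f e₀).ker :=
    (ContinuousLinearMap.id ℝ E - L.comp (fderiv ℝ f e₀)).codRestrict _ fun v => by
      simp [hL']
  have hκ : ∀ v, (κ v : E) = v - L (fderiv ℝ f e₀ v) := fun v => rfl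
  have hbij : Function.Bijective ((fderiv ℝ f e₀).prod κ : E →ₗ[ℝ] T × (fderiv ℝ f e₀).ker) := by
    constructor
    · rw [injective_iff_map_eq_zero]
      intro v hv
      have h1 : fderiv ℝ f e₀ v = 0 := congrArg Prod.fst hv
      have h2 : (κ v : E) = 0 := congrArg (fun z => (z.2 : E)) hv
      rw [hκ, h1, map_zero, sub_zero] at h2
      exact h2
    · rintro ⟨y, w⟩
      have hw : fderiv ℝ f e₀ w = 0 := w.2
      refine ⟨L y + w, Prod.ext ?_ (Subtype.ext ?_)⟩
      · change fderiv ℝ f e₀ (L y + w) = y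
        rw [map_add, hL', hw, add_zero]
      · change (κ (L y + w) : E) = w
        rw [hκ, map_add, hL', hw]
        simp
  let A : E ≃L[ℝ] T × (fderiv ℝ f e₀).ker := (LinearEquiv.ofBijective _ hbij).toContinuousLinearEquiv
  have hφ : ContDiff ℝ 1 fun e => (f e, κ e) := hf.prodMk κ.contDiff
  have hφ' : HasFDerivAt (fun e => (f e, κ e)) (A : E →L[ℝ] T × (fderiv ℝ f e₀).ker) e₀ := by
    have : (A : E →L[ℝ] T × (fderiv ℝ f e₀).ker) = (fderiv ℝ f e₀).prod κ := by
      ext v <;> rfl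
    rw [this]
    exact (hf.differentiable one_ne_zero e₀).hasFDerivAt.prodMk κ.hasFDerivAt
  refine ⟨κ, hφ.contDiffAt.toOpenPartialHomeomorph _ hφ' one_ne_zero,
    hφ.contDiffAt.mem_toOpenPartialHomeomorph_source hφ' one_ne_zero, fun e => rfl, ?_⟩
  exact hφ.contDiffAt.to_localInverse hφ' one_ne_zero

/-- Constant rank theorem: where the rank of `DH` does not exceed the dimension of `T`, and
`π ∘ H` is a submersion to `T`, the value of `H` is locally determined by that of `π ∘ H`. -/
theorem exists_nhds_eq_of_rank_le {H : E → F} (hH : ContDiff ℝ 1 H) (π : F →L[ℝ] T)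
    (hr : ∀ e, Module.finrank ℝ (fderiv ℝ H e).range ≤ Module.finrank ℝ T) {e₀ : E}
    (hs : (fderiv ℝ (fun e => π (H e)) e₀).range = ⊤) :
    ∃ U ∈ 𝓝 e₀, ∀ e ∈ U, ∀ e' ∈ U, π (H e) = π (H e') → H e = H e' := by
  have hf : ContDiff ℝ 1 fun e => π (H e) := π.contDiff.comp hH
  obtain ⟨κ, Φ, he₀, hΦ, hsymm⟩ := exists_chart_of_submersion hf hs
  have hN : ∀ᶠ z in 𝓝 (Φ e₀), z ∈ Φ.target ∧ ContDiffAt ℝ 1 Φ.symm z :=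
    (show ∀ᶠ z in 𝓝 (Φ e₀), z ∈ Φ.target from
      Φ.open_target.mem_nhds (Φ.map_source he₀)).and (hsymm.eventually (by simp))
  obtain ⟨ρ, hρ, hball⟩ := Metric.eventually_nhds_iff_ball.1 hN
  refine ⟨Φ.source ∩ Φ ⁻¹' Metric.ball (Φ e₀) ρ, ?_, ?_⟩
  · exact inter_mem (Φ.open_source.mem_nhds he₀)
      ((Φ.continuousAt he₀).preimage_mem_nhds (Metric.ball_mem_nhds _ hρ))
  rintro e ⟨he, heb⟩ e' ⟨he', heb'⟩ hee
  rw [mem_preimage] at heb heb'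
  -- The segment between the two points of the chart runs in a fibre of the first coordinate.
  set z := Φ e with hz
  set z' := Φ e' with hz'
  have hdiff : z' - z = (0, κ e' - κ e) := by
    rw [hz, hz', hΦ, hΦ, Prod.mk_sub_mk, hee, sub_self]
  have hseg : ∀ σ ∈ Icc (0 : ℝ) 1, z + σ • (z' - z) ∈ Metric.ball (Φ e₀) ρ := fun σ hσ =>
    (convex_ball (Φ e₀) ρ).add_smul_sub_mem heb heb' hσ
  have hder : ∀ σ ∈ Icc (0 : ℝ) 1,
      HasDerivAt (fun σ : ℝ => H (Φ.symm (z + σ • (z' - z)))) 0 σ := by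
    intro σ hσ
    obtain ⟨hzt, hzd⟩ := hball _ (hseg σ hσ)
    set q := z + σ • (z' - z)
    have h1 := (hH.differentiable one_ne_zero (Φ.symm q)).hasFDerivAt.comp q
      (hzd.differentiableAt one_ne_zero).hasFDerivAt
    set A := (fderiv ℝ H (Φ.symm q)).comp (fderiv ℝ Φ.symm q)
    have hπA : π.comp A = ContinuousLinearMap.fst ℝ T _ := by
      have h2 : HasFDerivAt (fun w => π (H (Φ.symm w))) (π.comp A) q :=
        π.hasFDerivAt.comp q h1
      refine h2.unique (hasFDerivAt_fst.congr_of_eventuallyEq ?_)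
      filter_upwards [Φ.open_target.mem_nhds hzt] with w hw
      have h3 := hΦ (Φ.symm w)
      rw [Φ.right_inv hw] at h3
      exact (congrArg Prod.fst h3).symm
    have hA0 : A (z' - z) = 0 := by
      rw [hdiff]
      refine apply_zero_prod_eq_zero A.toLinearMap (π : F →ₗ[ℝ] T) ?_ ?_ _
      · ext w <;> simpa using congr($hπA _)
      · refine le_trans (Submodule.finrank_mono ?_) (hr (Φ.symm q))
        rintro _ ⟨w, rfl⟩
        exact ⟨_, rfl⟩
    have h4 : HasDerivAt (fun σ : ℝ => z + σ • (z' - z)) (z' - z) σ := by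
      simpa using ((hasDerivAt_id σ).smul_const (z' - z)).const_add z
    have h5 := h1.comp_hasDerivAt σ h4
    rwa [hA0] at h5
  have hconst := constant_of_has_deriv_right_zero (a := (0 : ℝ)) (b := 1)
    (fun σ hσ => (hder σ hσ).continuousAt.continuousWithinAt)
    (fun σ hσ => (hder σ (Ico_subset_Icc_self hσ)).hasDerivWithinAt) 1 (by simp)
  simp only [one_smul, add_sub_cancel, zero_smul, add_zero] at hconst
  rw [hz, hz', Φ.left_inv he, Φ.left_inv he'] at hconst
  exact hconst.symm

/-- Local right inverse of a submersion. -/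
theorem exists_section_of_submersion {S : Type*} [NormedAddCommGroup S] [NormedSpace ℝ S]
    [CompleteSpace S] {f : S → T} (hf : ContDiff ℝ 1 f) {s₀ : S}
    (hs : (fderiv ℝ f s₀).range = ⊤) :
    ∃ sec : T → S, Tendsto sec (𝓝 (f s₀)) (𝓝 s₀) ∧ ∀ᶠ y in 𝓝 (f s₀), f (sec y) = y := by
  have hstrict := (hf.contDiffAt (x := s₀)).hasStrictFDerivAt one_ne_zero
  refine ⟨fun y => hstrict.implicitFunction f _ hs y 0,
    hstrict.tendsto_implicitFunction hs tendsto_id tendsto_const_nhds, ?_⟩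
  have : Tendsto (fun y : T => (y, (0 : (fderiv ℝ f s₀).ker))) (𝓝 (f s₀)) (𝓝 (f s₀, 0)) :=
    tendsto_id.prodMk_nhds tendsto_const_nhds
  exact this.eventually (hstrict.map_implicitFunction_eq hs)

end ConstantRank

/-! ### Submersions and null sets -/

section Submersion

variable {E T : Type*} [NormedAddCommGroup E] [NormedSpace ℝ E] [FiniteDimensional ℝ E]
  [MeasurableSpace E] [BorelSpace E]
  [NormedAddCommGroup T] [NormedSpace ℝ T] [FiniteDimensional ℝ T]
  [MeasurableSpace T] [BorelSpace T]

/-- A submersion does not map sets of positive measure to null sets, in the form: if the preimage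
of `Z` is null near `e₀`, then `Z` is null near the image of `e₀`. With a right inverse `L`
of the derivative, almost every `e` near `e₀` has `e + L y` outside the null set for almost every
`y`, and `y ↦ f (e + L y)` covers a neighbourhood of the image of `e₀`. -/
theorem exists_nhds_null_of_submersion (μ : Measure E) [μ.IsAddHaarMeasure] (τ : Measure T)
    [τ.IsAddHaarMeasure] {f : E → T} (hf : ContDiff ℝ 1 f) {e₀ : E}
    (hs : (fderiv ℝ f e₀).range = ⊤) {U : Set E} (hU : U ∈ 𝓝 e₀) {Z : Set T}
    (hZ : μ (U ∩ f ⁻¹' Z) = 0) : ∃ B ∈ 𝓝 (f e₀), τ (B ∩ Z) = 0 := by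
  obtain ⟨L, hL⟩ := (fderiv ℝ f e₀).exists_rightInverse_of_surjective hs
  have hL' : ∀ y, fderiv ℝ f e₀ (L y) = y := fun y => congr($hL y)
  have hstrict := (hf.contDiffAt (x := e₀)).hasStrictFDerivAt one_ne_zero
  obtain ⟨c, hc, hcL⟩ : ∃ c : NNReal, 0 < c ∧ (c : ℝ) * ‖L‖ ≤ 1 / 2 := by
    refine ⟨(2 * (‖L‖₊ + 1))⁻¹, by positivity, ?_⟩
    push_cast
    rw [inv_mul_le_iff₀ (by positivity)]
    linarith [norm_nonneg L]
  obtain ⟨s, hs0, happ⟩ := hstrict.approximates_deriv_on_nhds (Or.inr hc)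
  obtain ⟨ρ, hρ, hball⟩ := Metric.mem_nhds_iff.1 (inter_mem hs0 hU)
  set δ : ℝ := ρ / 2 / (‖L‖ + 1) with hδdef
  have hδ : 0 < δ := by positivity
  have hmem : ∀ e ∈ Metric.ball e₀ (ρ / 2), ∀ y ∈ Metric.ball (0 : T) δ, e + L y ∈ s ∩ U := by
    intro e he y hy
    refine hball ?_
    rw [mem_ball_iff_norm] at he ⊢
    rw [mem_ball_zero_iff] at hy
    have h1 : ‖L y‖ < ρ / 2 := by
      calc ‖L y‖ ≤ ‖L‖ * ‖y‖ := L.le_opNorm y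
        _ ≤ (‖L‖ + 1) * ‖y‖ := by gcongr; linarith
        _ < (‖L‖ + 1) * δ := by gcongr
        _ = ρ / 2 := by rw [hδdef]; field_simp
    calc ‖e + L y - e₀‖ = ‖(e - e₀) + L y‖ := by congr 1; abel
      _ ≤ ‖e - e₀‖ + ‖L y‖ := norm_add_le _ _
      _ < ρ := by linarith
  set N := toMeasurable μ (U ∩ f ⁻¹' Z) with hN
  have hN0 : μ N = 0 := by rw [hN, measure_toMeasurable, hZ]
  have hae : ∀ᵐ e ∂μ, ∀ᵐ y ∂τ, e + L y ∉ N := by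
    rw [← Measure.ae_ae_comm]
    · refine Eventually.of_forall fun y => ?_
      rw [ae_iff]
      simp only [not_not]
      exact (measure_preimage_add_right μ (L y) N).trans hN0
    · exact ((measurableSet_toMeasurable _ _).preimage
        (by fun_prop : Measurable fun p : T × E => p.2 + L p.1)).compl
  obtain ⟨e, ⟨he, hfe⟩, hey⟩ : ∃ e,
      (e ∈ Metric.ball e₀ (ρ / 2) ∧ f e ∈ Metric.ball (f e₀) (δ / 8)) ∧ ∀ᵐ y ∂τ, e + L y ∉ N := by
    by_contra hcon
    push Not at hcon
    have hnhds : Metric.ball e₀ (ρ / 2) ∩ f ⁻¹' Metric.ball (f e₀) (δ / 8) ∈ 𝓝 e₀ :=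
      inter_mem (Metric.ball_mem_nhds _ (by positivity))
        (hf.continuous.continuousAt.preimage_mem_nhds (Metric.ball_mem_nhds _ (by positivity)))
    exact (μ.measure_pos_of_mem_nhds hnhds).ne' (measure_mono_null hcon (ae_iff.1 hae))
  set g : T → T := fun y => f (e + L y) with hg
  have hgapp : ApproximatesLinearOn g (ContinuousLinearMap.id ℝ T) (Metric.ball 0 δ) (1 / 2) := by
    intro y hy y' hy'
    have := happ _ (hmem e he y hy).1 _ (hmem e he y' hy').1
    rw [add_sub_add_left_eq_sub, ← map_sub, hL'] at this
    refine this.trans ?_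
    calc (c : ℝ) * ‖L (y - y')‖ ≤ c * (‖L‖ * ‖y - y'‖) := by gcongr; exact L.le_opNorm _
      _ = c * ‖L‖ * ‖y - y'‖ := by ring
      _ ≤ 1 / 2 * ‖y - y'‖ := by gcongr
      _ = _ := by norm_num
  -- The right inverse is given the norm bound `1`, also when `T` is trivial and `‖id‖ = 0`.
  have hcov := hgapp.surjOn_closedBall_of_nonlinearRightInverse
    ⟨id, 1, fun y => by simp, fun y => rfl⟩ (b := 0) (ε := δ / 2) (by positivity)
    (Metric.closedBall_subset_ball (by linarith))
  refine ⟨Metric.ball (f e₀) (δ / 8), Metric.ball_mem_nhds _ (by positivity), ?_⟩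
  have hsub : Metric.ball (f e₀) (δ / 8) ∩ Z ⊆ g '' (Metric.ball 0 δ ∩ g ⁻¹' Z) := by
    rintro w ⟨hw, hwZ⟩
    have hw' : w ∈ Metric.closedBall (g 0)
        ((((1 : NNReal) : ℝ)⁻¹ - ((1 / 2 : NNReal) : ℝ)) * (δ / 2)) := by
      rw [mem_closedBall_iff_norm]
      rw [mem_ball_iff_norm] at hw hfe
      have hg0 : g 0 = f e := by simp [hg]
      rw [hg0]
      have : ‖w - f e‖ ≤ ‖w - f e₀‖ + ‖f e - f e₀‖ := by
        rw [← norm_sub_rev (f e₀) (f e)]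
        exact norm_sub_le_norm_sub_add_norm_sub _ _ _
      push_cast
      linarith
    obtain ⟨y, hy, rfl⟩ := hcov hw'
    exact ⟨y, ⟨Metric.closedBall_subset_ball (by linarith) hy, hwZ⟩, rfl⟩
  refine measure_mono_null hsub ?_
  refine addHaar_image_eq_zero_of_differentiableOn_of_addHaar_eq_zero τ ?_ ?_
  · exact ((hf.differentiable one_ne_zero).comp (by fun_prop)).differentiableOn
  · refine measure_mono_null ?_ (ae_iff.1 hey)
    rintro y ⟨hy, hyZ⟩
    simp only [not_not, mem_ofPred_eq]
    exact subset_toMeasurable _ _ ⟨(hmem e he y hy).2, hyZ⟩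

/-- Let `H` have rank at most `dim T` and let `s ↦ π (H (r₀, s))` be a submersion to `T`
at `s₀`, with local right inverse `sec`. If `H` avoids `A` almost everywhere near `(r₀, s₀)`,
then `y ↦ H (r₀, sec y)` avoids `A` almost everywhere near the base point. The point is that the
latter map involves only the partial function at `r₀`. -/
theorem exists_nhds_null_section {R S F : Type*}
    [NormedAddCommGroup R] [NormedSpace ℝ R] [FiniteDimensional ℝ R]
    [NormedAddCommGroup S] [NormedSpace ℝ S] [FiniteDimensional ℝ S]
    [NormedAddCommGroup F] [NormedSpace ℝ F] [MeasurableSpace R] [MeasurableSpace S]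
    [BorelSpace (R × S)] (μ : Measure (R × S)) [μ.IsAddHaarMeasure]
    (τ : Measure T) [τ.IsAddHaarMeasure] {H : R × S → F} (hH : ContDiff ℝ 1 H) (π : F →L[ℝ] T)
    (hr : ∀ e, Module.finrank ℝ (fderiv ℝ H e).range ≤ Module.finrank ℝ T) {r₀ : R} {s₀ : S}
    (hs : (fderiv ℝ (fun s => π (H (r₀, s))) s₀).range = ⊤) {sec : T → S}
    (hsec : Tendsto sec (𝓝 (π (H (r₀, s₀)))) (𝓝 s₀))
    (hsec' : ∀ᶠ y in 𝓝 (π (H (r₀, s₀))), π (H (r₀, sec y)) = y)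
    {A : Set F} {U : Set (R × S)} (hU : U ∈ 𝓝 (r₀, s₀)) (hA : μ (U ∩ H ⁻¹' A) = 0) :
    ∃ B ∈ 𝓝 (π (H (r₀, s₀))), τ (B ∩ {y | H (r₀, sec y) ∈ A}) = 0 := by
  have hf : ContDiff ℝ 1 fun e => π (H e) := π.contDiff.comp hH
  have hs' : (fderiv ℝ (fun e => π (H e)) (r₀, s₀)).range = ⊤ := by
    have h1 := (hf.differentiable one_ne_zero (r₀, s₀)).hasFDerivAt.comp s₀
      (hasFDerivAt_prodMk_right r₀ s₀)
    have h2 := h1.fderiv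
    rw [Function.comp_def] at h2
    rw [h2] at hs
    refine top_unique (hs.symm.le.trans ?_)
    rintro _ ⟨w, rfl⟩
    exact ⟨_, rfl⟩
  obtain ⟨U', hU', hdet⟩ := exists_nhds_eq_of_rank_le hH π hr hs'
  have hcont : Tendsto (fun e => π (H e)) (𝓝 (r₀, s₀)) (𝓝 (π (H (r₀, s₀)))) :=
    hf.continuous.tendsto _
  -- Near the base point, `H` is the composition of `π ∘ H` with `y ↦ H (r₀, sec y)`.
  have hfac : ∀ᶠ e in 𝓝 (r₀, s₀), H (r₀, sec (π (H e))) = H e := by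
    have h1 : ∀ᶠ e in 𝓝 (r₀, s₀), (r₀, sec (π (H e))) ∈ U' :=
      (tendsto_const_nhds.prodMk_nhds (hsec.comp hcont)).eventually hU'
    filter_upwards [h1, hcont.eventually hsec', hU'] with e he1 he2 he3
    exact hdet _ he1 _ he3 he2
  refine exists_nhds_null_of_submersion μ τ hf hs' (inter_mem hU hfac) (measure_mono_null ?_ hA)
  rintro e ⟨⟨heU, hef⟩, heA⟩
  refine ⟨heU, ?_⟩
  have heA' : H (r₀, sec (π (H e))) ∈ A := heA
  rwa [mem_preimage, ← (show H (r₀, sec (π (H e))) = H e from hef)]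

end Submersion

/-! ### Invariant measures of Markov kernels -/

section MarkovKernel

variable {X : Type*} [MeasurableSpace X] {κ : Kernel X X}

theorem comp_mono {η μ : Measure X} (h : η ≤ μ) : η.bind κ ≤ μ.bind κ := by
  refine Measure.le_iff.2 fun s hs => ?_
  rw [Measure.bind_apply hs κ.measurable.aemeasurable,
    Measure.bind_apply hs κ.measurable.aemeasurable]
  exact lintegral_mono' h le_rfl

theorem comp_univ [IsMarkovKernel κ] (μ : Measure X) : μ.bind κ univ = μ univ := by
  rw [Measure.bind_apply .univ κ.measurable.aemeasurable]
  simp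

/-- A finite measure that does not grow under a Markov kernel is invariant, as its mass is
preserved. -/
theorem invariant_of_comp_le [IsMarkovKernel κ] {η : Measure X} [IsFiniteMeasure η]
    (h : η.bind κ ≤ η) : κ.Invariant η := by
  have : IsFiniteMeasure (η.bind κ) := ⟨(comp_univ (κ := κ) η).trans_lt (measure_lt_top η univ)⟩
  exact Measure.eq_of_le_of_measure_univ_eq h (comp_univ η)

theorem invariant_of_add {η α μ : Measure X} [IsFiniteMeasure η] (hμ : κ.Invariant μ)
    (hη : κ.Invariant η) (hadd : η + α = μ) : κ.Invariant α := by
  have h1 : η + α.bind κ = η + α := by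
    conv_lhs => rw [← hη.def]
    rw [← Measure.comp_add, hadd, hμ.def]
  exact (Measure.add_right_inj η _ _).1 h1

theorem ae_kernel_eq_zero {α : Measure X} (hα : κ.Invariant α) {A : Set X} (hA : MeasurableSet A)
    (h : α A = 0) : ∀ᵐ x ∂α, κ x A = 0 := by
  rw [← hα.def, Measure.bind_apply hA κ.measurable.aemeasurable,
    lintegral_eq_zero_iff (κ.measurable_coe hA)] at h
  exact h

/-- If a Markov kernel has two invariant probability measures, then it has two nonzero finite ones
that are mutually singular: the parts of the given measures in excess of their infimum. -/
theorem exists_mutuallySingular_invariant [IsMarkovKernel κ] {μ ν : Measure X}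
    [IsProbabilityMeasure μ] [IsProbabilityMeasure ν] (hμ : κ.Invariant μ) (hν : κ.Invariant ν)
    (hne : μ ≠ ν) : ∃ α β : Measure X, IsFiniteMeasure α ∧ IsFiniteMeasure β ∧ κ.Invariant α ∧
      κ.Invariant β ∧ α ≠ 0 ∧ β ≠ 0 ∧ α ⟂ₘ β := by
  set η := μ ⊓ ν with hη
  have hημ : η ≤ μ := inf_le_left
  have hην : η ≤ ν := inf_le_right
  have : IsFiniteMeasure η := isFiniteMeasure_of_le μ hημ
  have hηinv : κ.Invariant η := invariant_of_comp_le
    (le_inf ((comp_mono hημ).trans hμ.def.le) ((comp_mono hην).trans hν.def.le))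
  have hα : η + (μ - η) = μ := by rw [add_comm, Measure.sub_add_cancel_of_le hημ]
  have hβ : η + (ν - η) = ν := by rw [add_comm, Measure.sub_add_cancel_of_le hην]
  refine ⟨μ - η, ν - η, inferInstance, inferInstance, invariant_of_add hμ hηinv hα,
    invariant_of_add hν hηinv hβ, fun h => hne ?_, fun h => hne ?_, ?_⟩
  · rw [h, add_zero] at hα
    exact Measure.eq_of_le_of_measure_univ_eq (hα ▸ hην) (by simp)
  · rw [h, add_zero] at hβ
    exact (Measure.eq_of_le_of_measure_univ_eq (hβ ▸ hημ) (by simp)).symm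
  · refine Measure.mutuallySingular_of_disjoint fun θ hθα hθβ => ?_
    have h1 : η + θ ≤ η := le_inf ((add_le_add_right hθα η).trans hα.le)
      ((add_le_add_right hθβ η).trans hβ.le)
    have h2 : η + θ = η + 0 := 
      le_antisymm (by simpa using h1) (by simpa using Measure.le_add_right le_rfl)
    exact ((Measure.add_right_inj η _ _).1 h2).le

/-- Among the null sets of `l` there is one of maximal mass for a finite measure `μ`; off that set,
`μ` is absolutely continuous. No finiteness of `l` is needed. -/
theorem exists_null_restrict_compl_absolutelyContinuous (l μ : Measure X) [IsFiniteMeasure μ] :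
    ∃ N : Set X, MeasurableSet N ∧ l N = 0 ∧ μ.restrict Nᶜ ≪ l := by
  set S : Set ENNReal := {r | ∃ N : Set X, MeasurableSet N ∧ l N = 0 ∧ μ N = r} with hS
  obtain ⟨u, -, hu, huS⟩ := exists_seq_tendsto_sSup (S := S)
    ⟨0, ∅, .empty, measure_empty, measure_empty⟩ (OrderTop.bddAbove S)
  choose M hMm hMl hMu using huS
  have hNm : MeasurableSet (⋃ i, M i) := .iUnion hMm
  have hNl : l (⋃ i, M i) = 0 := measure_iUnion_null hMl
  have hmax : sSup S ≤ μ (⋃ i, M i) :=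
    le_of_tendsto' hu fun i => (hMu i).symm.le.trans (measure_mono (subset_iUnion M i))
  refine ⟨⋃ i, M i, hNm, hNl, Measure.AbsolutelyContinuous.mk fun s hs hs0 => ?_⟩
  rw [Measure.restrict_apply hs, ← sdiff_eq]
  have h1 : μ ((⋃ i, M i) ∪ (s \ ⋃ i, M i)) ≤ μ (⋃ i, M i) := by
    refine le_trans (le_sSup ?_) hmax
    exact ⟨_, hNm.union (hs.diff hNm),
      measure_union_null hNl (measure_mono_null sdiff_subset hs0), rfl⟩
  rw [measure_union disjoint_sdiff_right (hs.diff hNm)] at h1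
  rw [← add_zero (μ (⋃ i, M i)), add_assoc, zero_add,
    ENNReal.add_le_add_iff_left (measure_ne_top μ _)] at h1
  exact le_antisymm h1 zero_le

/-- If a Markov kernel preserves absolute continuity with respect to `l`, and an invariant
finite measure `μ` is not absolutely continuous, then it has a nonzero invariant part that
lives on a null set of `l`. -/
theorem exists_invariant_restrict_null [IsMarkovKernel κ] {l μ : Measure X} [IsFiniteMeasure μ]
    (hμ : κ.Invariant μ)
    (hκ : ∀ ν : Measure X, IsFiniteMeasure ν → ν ≪ l → ν.bind κ ≪ l) (hac : ¬ μ ≪ l) :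
    ∃ N : Set X, MeasurableSet N ∧ l N = 0 ∧ κ.Invariant (μ.restrict N) ∧ μ.restrict N ≠ 0 := by
  obtain ⟨N, hNm, hN0, hN⟩ := exists_null_restrict_compl_absolutelyContinuous l μ
  have hadd : μ.restrict Nᶜ + μ.restrict N = μ := by
    rw [add_comm, Measure.restrict_add_restrict_compl hNm]
  refine ⟨N, hNm, hN0, invariant_of_add hμ (invariant_of_comp_le ?_) hadd, fun h => hac ?_⟩
  · refine Measure.le_iff.2 fun s hs => ?_
    have h0 : (μ.restrict Nᶜ).bind κ N = 0 := hκ _ inferInstance hN hN0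
    calc (μ.restrict Nᶜ).bind κ s = (μ.restrict Nᶜ).bind κ (s \ N) :=
          (measure_sdiff_null h0).symm
      _ ≤ μ.bind κ (s \ N) := comp_mono Measure.restrict_le_self _
      _ = μ.restrict Nᶜ s := by rw [hμ.def, Measure.restrict_apply hs, sdiff_eq]
  · rw [h, add_zero] at hadd
    rwa [hadd] at hN

end MarkovKernel

/-! ### The transition kernel of the splitting -/

section SplittingKernel

variable {d n : ℕ} {V : Fin n → Space d → Space d} {x₀ : Space d}

/-- The law of the times of one cycle: independent exponential times of mean one. -/
noncomputable def timeLaw (n : ℕ) : Measure (Fin n → ℝ) :=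
  (volume.restrict {t | ∀ k, 0 < t k}).withDensity fun t => ENNReal.ofReal (Real.exp (-∑ k, t k))

instance sFinite_timeLaw (n : ℕ) : SFinite (timeLaw n) := by
  unfold timeLaw
  infer_instance

theorem measurableSet_pos (n : ℕ) : MeasurableSet {t : Fin n → ℝ | ∀ k, 0 < t k} := by
  simp_rw [ofPred_forall]
  exact .iInter fun k => measurableSet_lt measurable_const (measurable_pi_apply k)

theorem ae_timeLaw_iff {p : (Fin n → ℝ) → Prop} :
    (∀ᵐ t ∂timeLaw n, p t) ↔ ∀ᵐ t : Fin n → ℝ, (∀ k, 0 < t k) → p t := by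
  rw [timeLaw, ae_withDensity_iff (by fun_prop), ae_restrict_iff' (measurableSet_pos n)]
  simp [Real.exp_pos]

theorem integral_timeLaw (g : (Fin n → ℝ) → ℝ) :
    ∫ t, g t ∂timeLaw n =
      ∫ t in {t : Fin n → ℝ | ∀ k, 0 < t k}, g t * Real.exp (-∑ k, t k) := by
  rw [timeLaw, integral_withDensity_eq_integral_toReal_smul (by fun_prop) (by simp)]
  simp [ENNReal.toReal_ofReal, Real.exp_nonneg, mul_comm]

theorem measurable_orbitCycle (hV : ∀ k, ContDiff ℝ 1 (V k)) (hc : ∀ k, IsCompleteField (V k)) :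
    Measurable fun p : (Fin n → ℝ) × orbit V x₀ => orbitCycle V x₀ p.1 p.2 :=
  (continuous_orbitCycle hV hc x₀).measurable

/-- The transition kernel of the random splitting on an orbit. -/
noncomputable def splittingKernel (hV : ∀ k, ContDiff ℝ 1 (V k))
    (hc : ∀ k, IsCompleteField (V k)) (x₀ : Space d) (h : ℝ) :
    Kernel (orbit V x₀) (orbit V x₀) where
  toFun x := (timeLaw n).map fun t => orbitCycle V x₀ (fun k => h * t k) x
  measurable' := by
    have hm : Measurable fun p : orbit V x₀ × (Fin n → ℝ) =>
        orbitCycle V x₀ (fun k => h * p.2 k) p.1 :=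
      (measurable_orbitCycle hV hc).comp (f := fun p : orbit V x₀ × (Fin n → ℝ) =>
        ((fun k => h * p.2 k : Fin n → ℝ), p.1)) (by fun_prop)
    refine Measure.measurable_of_measurable_coe _ fun A hA => ?_
    have : ∀ x : orbit V x₀, ((timeLaw n).map fun t => orbitCycle V x₀ (fun k => h * t k) x) A =
        timeLaw n (Prod.mk x ⁻¹' ((fun p : orbit V x₀ × (Fin n → ℝ) =>
          orbitCycle V x₀ (fun k => h * p.2 k) p.1) ⁻¹' A)) := fun x =>
      Measure.map_apply (hm.comp measurable_prodMk_left) hA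
    simp_rw [this]
    exact measurable_measure_prodMk_left (hm hA)

variable {hV : ∀ k, ContDiff ℝ 1 (V k)} {hc : ∀ k, IsCompleteField (V k)} {h : ℝ}

theorem splittingKernel_apply {A : Set (orbit V x₀)} (hA : MeasurableSet A) (x : orbit V x₀) :
    splittingKernel hV hc x₀ h x A =
      timeLaw n {t | orbitCycle V x₀ (fun k => h * t k) x ∈ A} :=
  Measure.map_apply ((measurable_orbitCycle hV hc).comp (f := fun t : Fin n → ℝ =>
    ((fun k => h * t k : Fin n → ℝ), x)) (by fun_prop)) hA

/-- On indicator functions the transition operator is the transition kernel. -/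
theorem transition_indicator {A : Set (orbit V x₀)} (hA : MeasurableSet A) (x : orbit V x₀) :
    transition V x₀ h (A.indicator 1) x = (splittingKernel hV hc x₀ h x).real A := by
  have hm : Measurable fun t : Fin n → ℝ => orbitCycle V x₀ (fun k => h * t k) x :=
    (measurable_orbitCycle hV hc).comp (f := fun t : Fin n → ℝ =>
      ((fun k => h * t k : Fin n → ℝ), x)) (by fun_prop)
  have h1 : transition V x₀ h (A.indicator 1) x =
      ∫ t, ((fun t : Fin n → ℝ => orbitCycle V x₀ (fun k => h * t k) x) ⁻¹' A).indicator
        (1 : (Fin n → ℝ) → ℝ) t ∂timeLaw n := by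
    rw [integral_timeLaw]
    rfl
  rw [h1, integral_indicator_one (hm hA), measureReal_def, measureReal_def,
    splittingKernel_apply hA]
  rfl

theorem integral_splittingKernel {μ : Measure (orbit V x₀)} (hμ : IsInvariant V x₀ h μ)
    {A : Set (orbit V x₀)} (hA : MeasurableSet A) :
    ∫ x, (splittingKernel hV hc x₀ h x).real A ∂μ = μ.real A := by
  have := hμ (A.indicator 1) (measurable_one.indicator hA)
    ⟨1, fun x => by by_cases hx : x ∈ A <;> simp [hx]⟩
  rw [integral_indicator_one hA] at this
  rw [← this]
  exact integral_congr_ae (Eventually.of_forall fun x => (transition_indicator hA x).symm)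

/-- The exponential law of the times is a probability measure. As the total mass of the kernel does
not depend on the starting point, this can be read off from any invariant probability measure. -/
theorem isMarkovKernel_splittingKernel {μ : Measure (orbit V x₀)} [IsProbabilityMeasure μ]
    (hμ : IsInvariant V x₀ h μ) : IsMarkovKernel (splittingKernel hV hc x₀ h) := by
  have h1 : ∀ x, splittingKernel hV hc x₀ h x univ = timeLaw n univ := fun x => by
    rw [splittingKernel_apply .univ]
    simp
  have h2 := integral_splittingKernel (hV := hV) (hc := hc) hμ .univ
  simp only [measureReal_def, h1, integral_const, measure_univ, ENNReal.toReal_one,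
    one_smul] at h2
  refine ⟨fun x => ⟨?_⟩⟩
  rw [h1, ← ENNReal.toReal_eq_one_iff]
  exact h2

theorem IsInvariant.invariant {μ : Measure (orbit V x₀)} [IsProbabilityMeasure μ]
    (hμ : IsInvariant V x₀ h μ) : (splittingKernel hV hc x₀ h).Invariant μ := by
  have := isMarkovKernel_splittingKernel (hV := hV) (hc := hc) hμ
  refine Measure.ext fun A hA => ?_
  rw [Measure.bind_apply hA (Kernel.measurable _).aemeasurable]
  have h1 := integral_splittingKernel (hV := hV) (hc := hc) hμ hA
  simp only [measureReal_def] at h1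
  rw [integral_toReal (Kernel.measurable_coe _ hA).aemeasurable
    (Eventually.of_forall fun x => measure_lt_top _ _)] at h1
  refine (ENNReal.toReal_eq_toReal_iff' ?_ (measure_ne_top μ A)).1 h1
  refine ((lintegral_mono fun x => prob_le_one).trans_lt ?_).ne
  simp

/-- The kernel preserves absolute continuity, as each cycle pulls null sets of the volume back to
null sets. -/
theorem comp_splittingKernel_absolutelyContinuous {ν : Measure (orbit V x₀)} [IsFiniteMeasure ν]
    (hν : ν ≪ orbitVolume V x₀) :
    ν.bind (splittingKernel hV hc x₀ h) ≪ orbitVolume V x₀ := by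
  refine Measure.AbsolutelyContinuous.mk fun A hA hA0 => ?_
  have hm : Measurable fun p : orbit V x₀ × (Fin n → ℝ) =>
      orbitCycle V x₀ (fun k => h * p.2 k) p.1 :=
    (measurable_orbitCycle hV hc).comp (f := fun p : orbit V x₀ × (Fin n → ℝ) =>
      ((fun k => h * p.2 k : Fin n → ℝ), p.1)) (by fun_prop)
  rw [Measure.bind_apply hA (Kernel.measurable _).aemeasurable,
    lintegral_eq_zero_iff (Kernel.measurable_coe _ hA)]
  have h1 : ∀ᵐ x ∂ν, ∀ᵐ t ∂timeLaw n, orbitCycle V x₀ (fun k => h * t k) x ∉ A := by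
    rw [Measure.ae_ae_comm (hm hA).compl]
    refine Eventually.of_forall fun t => ?_
    rw [ae_iff]
    simp only [not_not]
    exact hν (orbitVolume_preimage_orbitCycle_eq_zero hV hc _ hA0)
  filter_upwards [h1] with x hx
  rw [ae_iff] at hx
  simpa [splittingKernel_apply hA] using hx

/-- Almost no positive times of `m` cycles lead from `x` into `A`. -/
def AlmostAvoids (V : Fin n → Space d → Space d) (x₀ : Space d) (m : ℕ) (A : Set (orbit V x₀))
    (x : orbit V x₀) : Prop :=
  ∀ᵐ t : Fin m → Fin n → ℝ, (∀ i k, 0 < t i k) → orbitCycles V x₀ m t x ∉ A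

theorem measurableSet_pos_cycles (m n : ℕ) :
    MeasurableSet {t : Fin m → Fin n → ℝ | ∀ i k, 0 < t i k} := by
  simp_rw [ofPred_forall]
  exact .iInter fun i => .iInter fun k => measurableSet_lt measurable_const (by fun_prop)

theorem measurableSet_almostAvoids (hV : ∀ k, ContDiff ℝ 1 (V k))
    (hc : ∀ k, IsCompleteField (V k)) (m : ℕ) {A : Set (orbit V x₀)} (hA : MeasurableSet A) :
    MeasurableSet {x | AlmostAvoids V x₀ m A x} := by
  have hS : MeasurableSet {p : orbit V x₀ × (Fin m → Fin n → ℝ) |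
      (∀ i k, 0 < p.2 i k) ∧ orbitCycles V x₀ m p.2 p.1 ∈ A} :=
    ((measurableSet_pos_cycles m n).preimage measurable_snd).inter
      (hA.preimage ((continuous_orbitCycles hV hc x₀ m).measurable.comp measurable_swap))
  have := measurable_measure_prodMk_left (ν := (volume : Measure (Fin m → Fin n → ℝ))) hS
    (measurableSet_singleton 0)
  refine (congrArg MeasurableSet (ext fun x => ?_)).mp this
  change volume {t : Fin m → Fin n → ℝ | (∀ i k, 0 < t i k) ∧ orbitCycles V x₀ m t x ∈ A} = 0 ↔
    volume {t : Fin m → Fin n → ℝ | ¬ ((∀ i k, 0 < t i k) → orbitCycles V x₀ m t x ∉ A)} = 0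
  simp only [Classical.not_imp, not_not]

/-- If the kernel does not charge `A` from `x`, then almost no positive times lead from `x` into
`A`; the scale `h` of the times is immaterial. -/
theorem ae_orbitCycle_notMem (hh : 0 < h) {A : Set (orbit V x₀)} (hA : MeasurableSet A)
    {x : orbit V x₀} (hx : splittingKernel hV hc x₀ h x A = 0) :
    ∀ᵐ t : Fin n → ℝ, (∀ k, 0 < t k) → orbitCycle V x₀ t x ∉ A := by
  rw [splittingKernel_apply hA] at hx
  have h1 : ∀ᵐ t ∂timeLaw n, orbitCycle V x₀ (fun k => h * t k) x ∉ A := by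
    rw [ae_iff]
    simpa using hx
  rw [ae_timeLaw_iff, ae_iff] at h1
  rw [ae_iff]
  have h2 := Measure.addHaar_preimage_smul (volume : Measure (Fin n → ℝ)) hh.ne'
    {t | ¬ ((∀ k, 0 < t k) → orbitCycle V x₀ t x ∉ A)}
  rw [measure_mono_null _ h1] at h2
  · refine (mul_eq_zero.1 h2.symm).resolve_left ?_
    rw [ENNReal.ofReal_eq_zero, not_le]
    positivity
  · intro t ht
    simpa [hh, Pi.smul_def] using ht

/-- Invariance, iterated: a null set of an invariant measure is avoided after `m` cycles, from almost
every starting point. -/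
theorem ae_almostAvoids (hh : 0 < h) {α : Measure (orbit V x₀)}
    (hα : (splittingKernel hV hc x₀ h).Invariant α) (m : ℕ) {A : Set (orbit V x₀)}
    (hA : MeasurableSet A) (hA0 : α A = 0) : ∀ᵐ x ∂α, AlmostAvoids V x₀ m A x := by
  induction m generalizing A with
  | zero =>
    filter_upwards [measure_eq_zero_iff_ae_notMem.1 hA0] with x hx
    exact Eventually.of_forall fun t _ => by simpa [orbitCycles, cycles] using hx
  | succ m ih =>
    have hA1 : MeasurableSet {x | splittingKernel hV hc x₀ h x A ≠ 0} :=
      (Kernel.measurable_coe _ hA (measurableSet_singleton 0)).compl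
    filter_upwards [ih hA1 (ae_kernel_eq_zero hα hA hA0)] with x hx
    have hm : Measurable fun p : (Fin n → ℝ) × (Fin m → Fin n → ℝ) =>
        orbitCycle V x₀ p.1 (orbitCycles V x₀ m p.2 x) :=
      ((continuous_orbitCycle hV hc x₀).comp (continuous_fst.prodMk
        ((continuous_orbitCycles hV hc x₀ m).comp
          (continuous_snd.prodMk continuous_const)))).measurable
    have hS : MeasurableSet {p : (Fin n → ℝ) × (Fin m → Fin n → ℝ) |
        (∀ i k, 0 < p.2 i k) → (∀ k, 0 < p.1 k) →
          orbitCycle V x₀ p.1 (orbitCycles V x₀ m p.2 x) ∉ A} :=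
      MeasurableSet.imp ((measurableSet_pos_cycles m n).preimage measurable_snd)
        (MeasurableSet.imp ((measurableSet_pos n).preimage measurable_fst) (hm hA).compl)
    have h1 : ∀ᵐ t : Fin m → Fin n → ℝ, ∀ᵐ s : Fin n → ℝ, (∀ i k, 0 < t i k) →
        (∀ k, 0 < s k) → orbitCycle V x₀ s (orbitCycles V x₀ m t x) ∉ A := by
      filter_upwards [hx] with t ht
      by_cases hpos : ∀ i k, 0 < t i k
      · filter_upwards [ae_orbitCycle_notMem hh hA (not_not.1 (ht hpos))] with s hs _ using hs
      · exact Eventually.of_forall fun s hpos' => absurd hpos' hpos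
    rw [← Measure.ae_ae_comm hS, ← Measure.ae_prod_iff_ae_ae hS] at h1
    have h2 := (volume_preserving_piFinSuccAbove (fun _ : Fin (m + 1) => Fin n → ℝ)
      (Fin.last m)).quasiMeasurePreserving.ae h1
    filter_upwards [h2] with t ht hpos
    have h3 := ht (fun i k => hpos _ k) (fun k => hpos _ k)
    have h4 : orbitCycles V x₀ (m + 1) t x = orbitCycle V x₀ (t (Fin.last m))
        (orbitCycles V x₀ m (fun i => t i.castSucc) x) := by
      refine Subtype.ext ?_
      simp [orbitCycles, orbitCycle, cycles, Fin.foldl_succ_last]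
    rw [h4]
    simpa [Fin.init_def, Fin.removeNth] using h3

end SplittingKernel

/-! ### Local parametrization of the orbit -/

section Leaf

variable {d n : ℕ} {V : Fin n → Space d → Space d} {x₀ : Space d}

instance isAddHaarMeasure_volume_pi (m n : ℕ) :
    (volume : Measure (Fin m → Fin n → ℝ)).IsAddHaarMeasure :=
  Measure.pi.isAddHaarMeasure _

/-- The point `x` reaches `y` by cycles with positive times `t`, at which the derivative with
respect to the times is onto the tangent space of the orbit. -/
def ReachesRegularly (V : Fin n → Space d → Space d) (x₀ y x : Space d) (m : ℕ)
    (t : Fin m → Fin n → ℝ) : Prop :=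
  (∀ i k, 0 < t i k) ∧ cycles V m t x = y ∧
    ∀ v ∈ tangentSpace V x₀ y, ∃ s : Fin m → Fin n → ℝ,
      fderiv ℝ (fun r : Fin m → Fin n → ℝ => cycles V m r x) t s = v

/-- Local parametrization `g` of the orbit near a point that is reached regularly from every point
of the orbit. It is a local section of the orthogonal projection to the tangent space, and it is
independent of the starting point: if almost no positive times lead from `x` into `A`, where one
first runs a suitable number of cycles and then a fixed number, then `g` avoids `A` almost
everywhere near the base point. -/
theorem exists_parametrization (hV : ∀ k, ContDiff ℝ 1 (V k)) (hc : ∀ k, IsCompleteField (V k))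
    {y : Space d} (hy : y ∈ orbit V x₀)
    (hreach : ∀ x ∈ orbit V x₀, ∃ (m : ℕ) (t : Fin m → Fin n → ℝ),
      ReachesRegularly V x₀ y x m t) :
    ∃ (g : tangentSpace V x₀ y → orbit V x₀) (a : tangentSpace V x₀ y) (l : ℕ),
      (∀ᶠ b in 𝓝 a, (tangentSpace V x₀ y).orthogonalProjectionOnto (g b : Space d) = b) ∧
      ∀ x : orbit V x₀, ∃ m, ∀ A : Set (orbit V x₀), MeasurableSet A →
        AlmostAvoids V x₀ m {z | ¬ AlmostAvoids V x₀ l A z} x →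
        ∃ B ∈ 𝓝 a, μHE[Module.finrank ℝ (tangentSpace V x₀ y)] (B ∩ g ⁻¹' A) = 0 := by
  set T := tangentSpace V x₀ y with hT
  set π := T.orthogonalProjectionOnto
  obtain ⟨l, u, hu, huy, hsurj⟩ := hreach y hy
  have hcyc := contDiff_cycles hV hc
  have hG : ContDiff ℝ 1 fun s : Fin l → Fin n → ℝ => cycles V l s y :=
    (hcyc l).comp (contDiff_id.prodMk contDiff_const)
  have hs : (fderiv ℝ (fun s : Fin l → Fin n → ℝ => π (cycles V l s y)) u).range = ⊤ := by
    have h1 : HasFDerivAt (fun s : Fin l → Fin n → ℝ => π (cycles V l s y))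
        (π.comp (fderiv ℝ (fun s : Fin l → Fin n → ℝ => cycles V l s y) u)) u :=
      π.hasFDerivAt.comp u (hG.differentiable one_ne_zero u).hasFDerivAt
    rw [h1.fderiv]
    refine LinearMap.range_eq_top.2 fun v => ?_
    obtain ⟨w, hw⟩ := hsurj v v.2
    refine ⟨w, ?_⟩
    change π (fderiv ℝ (fun s : Fin l → Fin n → ℝ => cycles V l s y) u w) = v
    rw [hw]
    exact T.orthogonalProjectionOnto_mem_subspace_eq_self v
  obtain ⟨sec, hsec, hsec'⟩ := exists_section_of_submersion (π.contDiff.comp hG) hs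
  simp only [Function.comp_def] at hsec hsec'
  refine ⟨fun b => orbitCycles V x₀ l (sec b) ⟨y, hy⟩, π (cycles V l u y), l, hsec', fun x => ?_⟩
  obtain ⟨m, t, ht, hty, -⟩ := hreach x x.2
  refine ⟨m, fun A hA hx => ?_⟩
  set H : (Fin m → Fin n → ℝ) × (Fin l → Fin n → ℝ) → Space d :=
    fun p => cycles V l p.2 (cycles V m p.1 x) with hHdef
  have hH : ContDiff ℝ 1 H := by
    have h1 : ContDiff ℝ 1 fun p : (Fin m → Fin n → ℝ) × (Fin l → Fin n → ℝ) =>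
        cycles V m p.1 (x : Space d) := (hcyc m).comp (contDiff_fst.prodMk contDiff_const)
    exact (hcyc l).comp (contDiff_snd.prodMk h1)
  have hHmem : ∀ p, H p ∈ orbit V x₀ := fun p =>
    cycles_mem_orbit x₀ p.2 (cycles_mem_orbit x₀ p.1 x.2)
  have hHt : ∀ s, H (t, s) = cycles V l s y := fun s => by rw [hHdef]; simp only [hty]
  have hr : ∀ e, Module.finrank ℝ (fderiv ℝ H e).range ≤ Module.finrank ℝ T := fun e => by
    refine (Submodule.finrank_mono (range_fderiv_le_tangentSpace hH hHmem e)).trans ?_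
    rw [finrank_tangentSpace_eq_orbitDim hV hc (hHmem e), hT,
      finrank_tangentSpace_eq_orbitDim hV hc hy]
  have hmeas : Measurable fun p : (Fin m → Fin n → ℝ) × (Fin l → Fin n → ℝ) =>
      orbitCycles V x₀ l p.2 (orbitCycles V x₀ m p.1 x) :=
    ((continuous_orbitCycles hV hc x₀ l).comp (continuous_snd.prodMk
      ((continuous_orbitCycles hV hc x₀ m).comp
        (continuous_fst.prodMk continuous_const)))).measurable
  have hae : ∀ᵐ p ∂(volume : Measure (Fin m → Fin n → ℝ)).prod
      (volume : Measure (Fin l → Fin n → ℝ)), (∀ i k, 0 < p.1 i k) → (∀ i k, 0 < p.2 i k) →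
        orbitCycles V x₀ l p.2 (orbitCycles V x₀ m p.1 x) ∉ A := by
    rw [Measure.ae_prod_iff_ae_ae]
    · filter_upwards [hx] with r hr
      by_cases hpos : ∀ i k, 0 < r i k
      · filter_upwards [not_not.1 (hr hpos)] with s hs _ using hs
      · exact Eventually.of_forall fun s hpos' => absurd hpos' hpos
    · exact MeasurableSet.imp ((measurableSet_pos_cycles m n).preimage measurable_fst)
        (MeasurableSet.imp ((measurableSet_pos_cycles l n).preimage measurable_snd)
          (hmeas hA).compl)
  have hU : {p : (Fin m → Fin n → ℝ) × (Fin l → Fin n → ℝ) |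
      (∀ i k, 0 < p.1 i k) ∧ ∀ i k, 0 < p.2 i k} ∈ 𝓝 (t, u) := by
    have h1 : ∀ (j : ℕ) (w : Fin j → Fin n → ℝ), (∀ i k, 0 < w i k) →
        ∀ᶠ w' in 𝓝 w, ∀ i k, 0 < w' i k := fun j w hw =>
      eventually_all.2 fun i => eventually_all.2 fun k =>
        (by fun_prop : Continuous fun w' : Fin j → Fin n → ℝ => w' i k).continuousAt.eventually
          (lt_mem_nhds (hw i k))
    exact (h1 m t ht).prod_nhds (h1 l u hu)
  have hkey := exists_nhds_null_section
    ((volume : Measure (Fin m → Fin n → ℝ)).prod (volume : Measure (Fin l → Fin n → ℝ)))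
    (μHE[Module.finrank ℝ T] : Measure T) hH π hr (r₀ := t) (s₀ := u) (sec := sec)
    (by simpa only [hHt] using hs) (by simpa only [hHt] using hsec)
    (by simpa only [hHt] using hsec') (A := Subtype.val '' A) hU ?_
  · obtain ⟨B, hB, hB0⟩ := hkey
    rw [hHt] at hB
    refine ⟨B, hB, measure_mono_null ?_ hB0⟩
    rintro b ⟨hb, hbA⟩
    exact ⟨hb, _, hbA, (hHt _).symm⟩
  · refine measure_mono_null ?_ (ae_iff.1 hae)
    rintro p ⟨⟨hp1, hp2⟩, z, hz, hzp⟩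
    have : orbitCycles V x₀ l p.2 (orbitCycles V x₀ m p.1 x) = z := Subtype.ext hzp.symm
    simp only [mem_ofPred_eq, Classical.not_imp, not_not]
    exact ⟨hp1, hp2, this ▸ hz⟩

/-- A set that is null for a nonzero invariant measure is avoided by the parametrization `g` of
`exists_parametrization`, almost everywhere near the base point. -/
theorem exists_nhds_null_of_invariant {hV : ∀ k, ContDiff ℝ 1 (V k)}
    {hc : ∀ k, IsCompleteField (V k)} {h : ℝ} (hh : 0 < h) {P : Type*} [TopologicalSpace P]
    [MeasurableSpace P] {τ : Measure P} {g : P → orbit V x₀} {a : P} {l : ℕ}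
    (hg : ∀ x : orbit V x₀, ∃ m, ∀ A : Set (orbit V x₀), MeasurableSet A →
      AlmostAvoids V x₀ m {z | ¬ AlmostAvoids V x₀ l A z} x → ∃ B ∈ 𝓝 a, τ (B ∩ g ⁻¹' A) = 0)
    {α : Measure (orbit V x₀)} (hα : (splittingKernel hV hc x₀ h).Invariant α) (hα0 : α ≠ 0)
    {A : Set (orbit V x₀)} (hA : MeasurableSet A) (hA0 : α A = 0) :
    ∃ B ∈ 𝓝 a, τ (B ∩ g ⁻¹' A) = 0 := by
  have h1 : α {z | ¬ AlmostAvoids V x₀ l A z} = 0 := ae_almostAvoids hh hα l hA hA0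
  have h2 := fun m => ae_almostAvoids hh hα m (measurableSet_almostAvoids hV hc l hA).compl h1
  have : (ae α).NeBot := ae_neBot.2 hα0
  obtain ⟨x, hx⟩ := (ae_all_iff.2 h2).exists
  obtain ⟨m, hm⟩ := hg x
  exact hm A hA (hx m)

/-- A null set of the volume of the orbit is null in the coordinates of a local section of the
orthogonal projection to a tangent space, since projections do not increase Hausdorff measure. -/
theorem exists_nhds_null_of_orbitVolume {y : Space d}
    (hdim : Module.finrank ℝ (tangentSpace V x₀ y) = orbitDim V x₀)
    {g : tangentSpace V x₀ y → orbit V x₀} {a : tangentSpace V x₀ y}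
    (hg : ∀ᶠ b in 𝓝 a, (tangentSpace V x₀ y).orthogonalProjectionOnto (g b : Space d) = b)
    {A : Set (orbit V x₀)} (hA : orbitVolume V x₀ A = 0) :
    ∃ B ∈ 𝓝 a, μHE[Module.finrank ℝ (tangentSpace V x₀ y)] (B ∩ g ⁻¹' A) = 0 := by
  refine ⟨_, hg, measure_mono_null (t := (tangentSpace V x₀ y).orthogonalProjectionOnto ''
    (Subtype.val '' A)) ?_ ?_⟩
  · rintro b ⟨hb, hbA⟩
    exact ⟨_, ⟨_, hbA, rfl⟩, hb⟩
  · rw [orbitVolume_eq_zero_iff] at hA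
    have hlip : LipschitzWith 1 (tangentSpace V x₀ y).orthogonalProjectionOnto :=
      ContinuousLinearMap.lipschitzWith_of_opNorm_le
        (Submodule.orthogonalProjectionOnto_norm_le _)
    have h1 := hlip.hausdorffMeasure_image_le (d := orbitDim V x₀) (Nat.cast_nonneg _)
      (Subtype.val '' A)
    rw [hA, mul_zero, nonpos_iff_eq_zero] at h1
    rw [hdim, Measure.euclideanHausdorffMeasure_def, Measure.smul_apply, h1, smul_zero]

end Leaf

end RandomSplitting

open RandomSplitting in
theorem theorem3p1 {d n : ℕ}
    (V : Fin n → RandomSplitting.Space d → RandomSplitting.Space d)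
    (hV : ∀ k, ContDiff ℝ 2 (V k))
    (hcomplete : ∀ k, RandomSplitting.IsCompleteField (V k))
    (x₀ : RandomSplitting.Space d) (h : ℝ) (hh : 0 < h)
    (hreach : ∃ xstar ∈ RandomSplitting.orbit V x₀, ∀ x ∈ RandomSplitting.orbit V x₀,
      ∃ (m : ℕ) (t : Fin m → Fin n → ℝ), (∀ i k, 0 < t i k) ∧
        RandomSplitting.cycles V m t x = xstar ∧
        ∀ v ∈ RandomSplitting.tangentSpace V x₀ xstar, ∃ s : Fin m → Fin n → ℝ,
          fderiv ℝ (fun r : Fin m → Fin n → ℝ => RandomSplitting.cycles V m r x) t s = v) :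
    (∀ μ ν : MeasureTheory.Measure (RandomSplitting.orbit V x₀),
      MeasureTheory.IsProbabilityMeasure μ → MeasureTheory.IsProbabilityMeasure ν →
      RandomSplitting.IsInvariant V x₀ h μ → RandomSplitting.IsInvariant V x₀ h ν → μ = ν) ∧
    (∀ μ : MeasureTheory.Measure (RandomSplitting.orbit V x₀),
      MeasureTheory.IsProbabilityMeasure μ → RandomSplitting.IsInvariant V x₀ h μ →
      μ.AbsolutelyContinuous (RandomSplitting.orbitVolume V x₀)) := by
  have hV1 : ∀ k, ContDiff ℝ 1 (V k) := fun k => (hV k).of_le one_le_two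
  obtain ⟨y, hy, hreach⟩ := hreach
  obtain ⟨g, a, l, hga, hg⟩ := exists_parametrization hV1 hcomplete hy hreach
  -- The preimages under `g` of a set and of its complement are not both null near `a`.
  have hcontra : ∀ A : Set (orbit V x₀),
      (∃ B ∈ nhds a, μHE[Module.finrank ℝ (tangentSpace V x₀ y)] (B ∩ g ⁻¹' A) = 0) →
      (∃ B ∈ nhds a, μHE[Module.finrank ℝ (tangentSpace V x₀ y)] (B ∩ g ⁻¹' Aᶜ) = 0) → False := by
    rintro A ⟨B, hB, hB0⟩ ⟨B', hB', hB0'⟩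
    refine (Measure.measure_pos_of_mem_nhds μHE[Module.finrank ℝ (tangentSpace V x₀ y)]
      (Filter.inter_mem hB hB')).ne' (measure_mono_null ?_ (measure_union_null hB0 hB0'))
    rintro b ⟨hb, hb'⟩
    by_cases hbA : g b ∈ A
    · exact Or.inl ⟨hb, hbA⟩
    · exact Or.inr ⟨hb', hbA⟩
  refine ⟨fun μ ν _ _ hμ hν => ?_, fun μ _ hμ => ?_⟩
  · by_contra hne
    have := isMarkovKernel_splittingKernel (hV := hV1) (hc := hcomplete) hμ
    obtain ⟨α, β, _, _, hα, hβ, hα0, hβ0, A, hA, hαA, hβA⟩ := exists_mutuallySingular_invariant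
      (hμ.invariant (hV := hV1) (hc := hcomplete)) hν.invariant hne
    exact hcontra A (exists_nhds_null_of_invariant hh hg hα hα0 hA hαA)
      (exists_nhds_null_of_invariant hh hg hβ hβ0 hA.compl hβA)
  · by_contra hac
    have := isMarkovKernel_splittingKernel (hV := hV1) (hc := hcomplete) hμ
    obtain ⟨N, hN, hN0, hinv, hne⟩ := exists_invariant_restrict_null
      (hμ.invariant (hV := hV1) (hc := hcomplete))
      (fun ν _ hν => comp_splittingKernel_absolutelyContinuous hν) hac
    refine hcontra N (exists_nhds_null_of_orbitVolume
      (finrank_tangentSpace_eq_orbitDim hV1 hcomplete hy) hga hN0)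
      (exists_nhds_null_of_invariant hh hg hinv hne hN.compl ?_)
    rw [Measure.restrict_apply hN.compl, Set.compl_inter_self, measure_empty]
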